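/- Conventions. $\mathbb R_+=[0,\infty)$; products carry the sup metric. A map $f:X\to Y$ of metric spaces is *controlled* if for every $r>0$ there is $s>0$ with $d(x,x')<r\Rightarrow d(f(x),f(x'))<s$, *proper* if preimages of bounded sets are bounded, and *coarse* if it is both (no continuity is required). For a coarse map $p:X\to\mathbb R_+$ put $I_pX=\{(x,t)\in X\times\mathbb R_+: t\le p(x)\}$. Coarse maps $f,g:X\to Y$ are *coarsely homotopic* if for some coarse $p:X\to\mathbb R_+$ there is a coarse map $H:I_pX\to Y$ with $H(x,0)=f(x)$ and $H(x,p(x))=g(x)$ for all $x$. - $X$ is *coarsely path-connected* if any two coarse $\mathbb R_+$-basepoints of $X$ are coarsely homotopic; a coarse $\mathbb R_+$-basepoint is a coarse map $\mathbb R_+\to X$ at bounded distance from a quasi-geodesic ray. - $A\subseteq X$ is *coarsely categorical* if the inclusion $A\hookrightarrow X$ is coarsely homotopic to $\alpha\circ j$ for some coarse maps $j:A\to\mathbb R_+$ and $\alpha:\mathbb R_+\to X$. The *coarse LS-category* $\text{c-cat}(X)\in\mathbb N\cup\{\infty\}$ is the least $k$ such that $X$ is covered by $k+1$ coarsely categorical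 sets ($\infty$ if there is none). - $\operatorname{asdim}X\le n$ if for every uniformly bounded open cover $\mathcal V$ of $X$ there is a uniformly bounded open cover $\mathcal U$ of multiplicity $\le n+1$ such that every member of $\mathcal V$ lies in a member of $\mathcal U$; $\operatorname{asdim}X$ is the least such $n\in\mathbb N$ ($\infty$ if there is none). - $X$ is *bicombable* if there is a controlled map $C:X\times X\times\mathbb N\to X$ with $C(p,x,0)=p=C(p,p,n)$ for all $p,x,n$, and such that for every $p\in X$ and every bounded $K\subseteq X$ there is $N$ with $C(p,x,n)=x$ for all $n\ge N$ and $x\in K$. A finitely generated group is regarded as a metric space through the word metric of a finite generating set. **Theorem.** Let $\Gamma$ be an infinite finitely generated group, with the word metric of a finite generating set, that is bicombable and coarsely path-connected. Then $$\text{c-cat}(\Gamma)\le\operatorname{asdim}(\Gamma).$$ Here $\text{c-cat}(\Gamma)$ may be read as $\text{c-cat}$ of $\Gamma$ with its word metric, or as $\text{c-cat}(X)$ for any nonempty proper geodesic metric space $X$ on which $\Gamma$ acts properly and cocompactly by isometries; the inequality holds for each of these readings. -/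

import Mathlib

open scoped NNReal Pointwise

noncomputable section

namespace CoarseLS

universe u v

/-! ### Coarse maps -/

section CoarseMaps

variable {X : Type u} {Y : Type v} [PseudoMetricSpace X] [PseudoMetricSpace Y]

/-- Controlled (bornologous) maps. -/
def IsControlled (f : X → Y) : Prop :=
  ∀ r : ℝ, 0 < r → ∃ s : ℝ, 0 < s ∧ ∀ x x' : X, dist x x' < r → dist (f x) (f x') < s

/-- (Metrically) proper maps: preimages of bounded sets are bounded. -/
def IsProperMap (f : X → Y) : Prop :=
  ∀ B : Set Y, Bornology.IsBounded B → Bornology.IsBounded (f ⁻¹' B)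

/-- Coarse maps; no continuity is required. -/
def IsCoarse (f : X → Y) : Prop :=
  IsControlled f ∧ IsProperMap f

/-- Two maps are close if they are a uniformly bounded distance apart. -/
def AreClose (f g : X → Y) : Prop :=
  ∃ M : ℝ, ∀ x : X, dist (f x) (g x) ≤ M

/-- The `p`-cylinder `I_p X = {(x, t) ∈ X × [0, ∞) | t ≤ p x}`, with the metric induced from the
product. -/
abbrev Cylinder (p : X → ℝ≥0) : Type u :=
  {z : X × ℝ≥0 // z.2 ≤ p z.1}

/-- The inclusion of `X` as the bottom `t = 0` of the cylinder. -/
def Cylinder.bot (p : X → ℝ≥0) (x : X) : Cylinder p :=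
  ⟨(x, 0), bot_le⟩

/-- The inclusion of `X` as the top `t = p x` of the cylinder. -/
def Cylinder.top (p : X → ℝ≥0) (x : X) : Cylinder p :=
  ⟨(x, p x), le_rfl⟩

/-- `f` and `g` are coarsely homotopic: there are a coarse map `p : X → [0, ∞)` and a coarse map
`H` on the `p`-cylinder which is `f` at the bottom and `g` at the top. -/
def CoarselyHomotopic (f g : X → Y) : Prop :=
  ∃ p : X → ℝ≥0, IsCoarse p ∧ ∃ H : Cylinder p → Y, IsCoarse H ∧
    (∀ x : X, H (Cylinder.bot p x) = f x) ∧ (∀ x : X, H (Cylinder.top p x) = g x)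

end CoarseMaps

section Invariants

variable (X : Type u) [PseudoMetricSpace X]

/-- Quasi-geodesic rays. -/
def IsQuasiGeodesicRay {X : Type u} [PseudoMetricSpace X] (f : ℝ≥0 → X) : Prop :=
  ∃ L C : ℝ, 1 ≤ L ∧ 0 ≤ C ∧ ∀ s t : ℝ≥0,
    L⁻¹ * dist s t - C ≤ dist (f s) (f t) ∧ dist (f s) (f t) ≤ L * dist s t + C

/-- Coarse `[0, ∞)`-basepoints: coarse rays that are close to a quasi-geodesic ray. -/
def IsCoarseBasepoint {X : Type u} [PseudoMetricSpace X] (f : ℝ≥0 → X) : Prop :=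
  IsCoarse f ∧ ∃ q : ℝ≥0 → X, IsQuasiGeodesicRay q ∧ AreClose f q

/-- Any two coarse basepoints are coarsely homotopic. -/
def IsCoarselyPathConnected : Prop :=
  ∀ f g : ℝ≥0 → X, IsCoarseBasepoint f → IsCoarseBasepoint g → CoarselyHomotopic f g

/-- `A ⊆ X` is coarsely categorical if its inclusion is coarsely homotopic to `α ∘ j` for some
coarse maps `j : A → [0, ∞)` and `α : [0, ∞) → X`. -/
def IsCoarselyCategorical {X : Type u} [PseudoMetricSpace X] (A : Set X) : Prop :=
  ∃ (α : ℝ≥0 → X) (j : A → ℝ≥0), IsCoarse α ∧ IsCoarse j ∧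
    CoarselyHomotopic (fun a : A => (a : X)) (α ∘ j)

/-- `X` is covered by `n + 1` coarsely categorical sets. -/
def CcatLE (n : ℕ) : Prop :=
  ∃ U : Fin (n + 1) → Set X, (∀ i, IsCoarselyCategorical (U i)) ∧ ⋃ i, U i = Set.univ

/-- The (reduced) coarse Lusternik–Schnirelmann category, `⊤` if there is no finite cover by
coarsely categorical sets. -/
def ccat : ℕ∞ :=
  ⨅ (n : ℕ) (_ : CcatLE X n), (n : ℕ∞)

/-- Uniformly bounded open covers. -/
def IsUniformlyBoundedOpenCover {X : Type u} [PseudoMetricSpace X] (𝒰 : Set (Set X)) : Prop :=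
  (∀ U ∈ 𝒰, IsOpen U) ∧ ⋃₀ 𝒰 = Set.univ ∧
    ∃ K : ℝ, ∀ U ∈ 𝒰, ∀ x ∈ U, ∀ y ∈ U, dist x y ≤ K

/-- `asdim X ≤ n`: every uniformly bounded open cover refines some uniformly bounded open cover
of multiplicity at most `n + 1`. -/
def AsdimLE (n : ℕ) : Prop :=
  ∀ 𝒱 : Set (Set X), IsUniformlyBoundedOpenCover 𝒱 →
    ∃ 𝒰 : Set (Set X), IsUniformlyBoundedOpenCover 𝒰 ∧
      (∀ x : X, {U ∈ 𝒰 | x ∈ U}.encard ≤ n + 1) ∧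
      ∀ V ∈ 𝒱, ∃ U ∈ 𝒰, V ⊆ U

/-- The asymptotic dimension (of a nonempty space), `⊤` if it is not finite. -/
def asdim : ℕ∞ :=
  ⨅ (n : ℕ) (_ : AsdimLE X n), (n : ℕ∞)

/-- `C`, written `C p x n`, is a bicombing on `X`: the path `C p x` starts at `p`, is eventually
constant equal to `x` (uniformly for `x` in a bounded set), is constant if `x = p`, and `C` is
controlled as a map on the product `X × X × ℕ`. -/
structure IsBicombing {X : Type u} [PseudoMetricSpace X] (C : X → X → ℕ → X) : Prop where
  start : ∀ p x : X, C p x 0 = p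
  const : ∀ (p : X) (n : ℕ), C p p n = p
  finish : ∀ (p : X) (K : Set X), Bornology.IsBounded K →
    ∃ N : ℕ, ∀ n : ℕ, N ≤ n → ∀ x ∈ K, C p x n = x
  controlled : IsControlled (fun z : X × X × ℕ => C z.1 z.2.1 z.2.2)

/-- `X` admits a bicombing. -/
def IsBicombable : Prop :=
  ∃ C : X → X → ℕ → X, IsBicombing C

/-- Geodesic spaces: any two points are joined by an isometrically embedded interval. -/
def IsGeodesicSpace : Prop :=
  ∀ x y : X, ∃ c : ℝ → X, c 0 = x ∧ c (dist x y) = y ∧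
    ∀ s ∈ Set.Icc 0 (dist x y), ∀ t ∈ Set.Icc 0 (dist x y), dist (c s) (c t) = |s - t|

end Invariants

/-! ### The word metric -/

section WordMetric

variable {Γ : Type u} [Group Γ]

/-- `g` is a product of `n` elements of `S ∪ S⁻¹`. -/
def IsWordOfLength (S : Set Γ) (g : Γ) (n : ℕ) : Prop :=
  ∃ l : List Γ, (∀ x ∈ l, x ∈ S ∨ x⁻¹ ∈ S) ∧ l.prod = g ∧ l.length = n

/-- The word length of `g` with respect to `S` (meaningful when `S` generates). -/
def wordLength (S : Set Γ) (g : Γ) : ℕ :=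
  sInf {n : ℕ | IsWordOfLength S g n}

theorem exists_isWordOfLength {S : Set Γ} (hS : Subgroup.closure S = ⊤) (g : Γ) :
    ∃ n, IsWordOfLength S g n := by
  have hg : g ∈ (Subgroup.closure S).toSubmonoid := by
    rw [hS]
    exact Subgroup.mem_top g
  rw [Subgroup.closure_toSubmonoid] at hg
  obtain ⟨l, hl, hp⟩ := Submonoid.exists_list_of_mem_closure hg
  exact ⟨_, l, hl, hp, rfl⟩

theorem isWordOfLength_wordLength {S : Set Γ} (hS : Subgroup.closure S = ⊤) (g : Γ) :
    IsWordOfLength S g (wordLength S g) :=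
  Nat.sInf_mem (s := {n : ℕ | IsWordOfLength S g n}) (exists_isWordOfLength hS g)

theorem wordLength_le {S : Set Γ} {g : Γ} {n : ℕ} (h : IsWordOfLength S g n) :
    wordLength S g ≤ n :=
  Nat.sInf_le h

theorem wordLength_one (S : Set Γ) : wordLength S (1 : Γ) = 0 :=
  Nat.le_zero.mp (wordLength_le ⟨[], by simp, by simp, rfl⟩)

theorem eq_one_of_wordLength_eq_zero {S : Set Γ} (hS : Subgroup.closure S = ⊤) {g : Γ}
    (h : wordLength S g = 0) : g = 1 := by
  obtain ⟨l, -, hp, hn⟩ := isWordOfLength_wordLength hS g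
  rw [h, List.length_eq_zero_iff] at hn
  simpa [hn] using hp.symm

theorem wordLength_mul_le {S : Set Γ} (hS : Subgroup.closure S = ⊤) (g h : Γ) :
    wordLength S (g * h) ≤ wordLength S g + wordLength S h := by
  obtain ⟨l, hl, hp, hn⟩ := isWordOfLength_wordLength hS g
  obtain ⟨l', hl', hp', hn'⟩ := isWordOfLength_wordLength hS h
  refine wordLength_le ⟨l ++ l', fun x hx => ?_, by simp [hp, hp'], by simp [hn, hn']⟩
  rcases List.mem_append.mp hx with hx | hx
  · exact hl x hx
  · exact hl' x hx

theorem wordLength_inv_le {S : Set Γ} (hS : Subgroup.closure S = ⊤) (g : Γ) :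
    wordLength S g⁻¹ ≤ wordLength S g := by
  obtain ⟨l, hl, hp, hn⟩ := isWordOfLength_wordLength hS g
  refine wordLength_le ⟨(l.map (·⁻¹)).reverse, fun x hx => ?_, ?_, by simp [hn]⟩
  · obtain ⟨y, hy, rfl⟩ := List.mem_map.mp (List.mem_reverse.mp hx)
    simpa using (hl y hy).symm
  · rw [← List.prod_inv_reverse, hp]

/-- The group `Γ`, regarded as a metric space with the (left-invariant) word metric
`d(g, h) = |g⁻¹ h|` of the generating set `S`. -/
def WordSpace (S : Set Γ) (_hS : Subgroup.closure S = ⊤) : Type u := Γ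

instance instMetricSpaceWordSpace (S : Set Γ) (hS : Subgroup.closure S = ⊤) :
    MetricSpace (WordSpace S hS) where
  dist g h := (@wordLength Γ _ S ((show Γ from g)⁻¹ * (show Γ from h)) : ℝ)
  dist_self g := by
    rw [inv_mul_cancel (G := Γ), wordLength_one, Nat.cast_zero]
  dist_comm g h := by
    have key : ∀ a b : Γ, wordLength S (a⁻¹ * b) ≤ wordLength S (b⁻¹ * a) := fun a b => by
      simpa using wordLength_inv_le hS (b⁻¹ * a)
    exact congrArg (Nat.cast : ℕ → ℝ) (le_antisymm (key g h) (key h g))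
  dist_triangle g h k := by
    have key : ∀ a b c : Γ,
        wordLength S (a⁻¹ * c) ≤ wordLength S (a⁻¹ * b) + wordLength S (b⁻¹ * c) :=
      fun a b c => by simpa [mul_assoc] using wordLength_mul_le hS (a⁻¹ * b) (b⁻¹ * c)
    exact_mod_cast key g h k
  eq_of_dist_eq_zero {g h} hgh := by
    have h0 : @wordLength Γ _ S ((show Γ from g)⁻¹ * (show Γ from h)) = 0 :=
      Nat.cast_eq_zero.mp hgh
    exact (inv_mul_eq_one (G := Γ)).mp (eq_one_of_wordLength_eq_zero hS h0)

end WordMetric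

/-- `X` is a proper geodesic (nonempty) metric space on which `Γ` acts properly and cocompactly
by isometries. -/
structure IsGeometricModel (Γ : Type u) [Group Γ] (X : Type v) [MetricSpace X]
    [MulAction Γ X] : Prop where
  nonempty : Nonempty X
  proper : ProperSpace X
  geodesic : IsGeodesicSpace X
  isometric : ∀ g : Γ, Isometry (fun x : X => g • x)
  properAction : ProperlyDiscontinuousSMul Γ X
  cocompact : ∃ K : Set X, IsCompact K ∧ ⋃ g : Γ, g • K = Set.univ

end CoarseLS

end

namespace CoarseLS

universe u v

/-! Write `Γ` as a union of `n + 1` sets, `n` bounding the asymptotic dimension, each of which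
breaks up far from a basepoint `o` into pieces whose mutual distances tend to infinity and whose
diameters are a small fraction of their distance to `o` (`AsdimLE.exists_collapse_cover`). Such sets
come from Ostrand colourings (`AsdimLE.exists_coloring`) at scales growing slowly with the distance
to `o`.

Each such set is coarsely categorical (`IsCollapse.isCoarselyCategorical`). The bicombing contracts
every piece to a representative `b`. It displaces points by at most a constant multiple of the
piece's size, so the contraction stays far from `o`. Then `b` is moved along a path to a fixed
geodesic ray. These paths can also be kept far out: coarse path-connectedness makes `Γ` one-ended
(`IsDiscreteGeodesic.exists_chainOutside_ray`). Since distinct pieces drift apart, no compatibility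
between their paths or durations is needed.

For a geometric model `X`, the orbit map has a coarse inverse
(`IsGeometricModel.exists_coarse_maps`), and categorical covers pull back
(`IsCoarselyCategorical.preimage`). -/

/-- Locally finite metric spaces with integral distances in which one can move from any point
towards any other one by steps of length `1`. -/
structure IsDiscreteGeodesic (X : Type u) [MetricSpace X] : Prop where
  dist_nat : ∀ x y : X, ∃ n : ℕ, dist x y = n
  step : ∀ x y : X, x ≠ y → ∃ z : X, dist x z = 1 ∧ dist x y = 1 + dist z y
  finite_closedBall : ∀ (x : X) (r : ℝ), (Metric.closedBall x r).Finite

/-- `x` and `y` are joined by a chain of points with steps of length at most `1` that stays at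
distance at least `R` from `o`. -/
def ChainOutside {X : Type u} [MetricSpace X] (o : X) (R : ℝ) : X → X → Prop :=
  Relation.ReflTransGen fun x y => dist x y ≤ 1 ∧ R ≤ dist o x ∧ R ≤ dist o y

/-! ### Chains and geodesic rays in discrete geodesic spaces. -/

section Chains

variable {X : Type u} [MetricSpace X]

theorem ChainOutside.symm {o : X} {R : ℝ} {x y : X} (h : ChainOutside o R x y) :
    ChainOutside o R y x := by
  induction h with
  | refl => exact .refl
  | tail _ hbc ih => exact .head ⟨by rw [dist_comm]; exact hbc.1, hbc.2.2, hbc.2.1⟩ ih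

theorem ChainOutside.exists_path {o : X} {R : ℝ} {x y : X} (h : ChainOutside o R x y)
    (hx : R ≤ dist o x) :
    ∃ (γ : ℕ → X) (l : ℕ), γ 0 = x ∧ (∀ n, l ≤ n → γ n = y) ∧
      (∀ n, dist (γ n) (γ (n + 1)) ≤ 1) ∧ ∀ n, R ≤ dist o (γ n) := by
  induction h using Relation.ReflTransGen.head_induction_on with
  | refl => exact ⟨fun _ => y, 0, rfl, fun _ _ => rfl, fun _ => by simp, fun _ => hx⟩
  | @head a c hac _ ih =>
    obtain ⟨γ, l, h0, hl, hs, hR⟩ := ih hac.2.2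
    refine ⟨fun n => Nat.casesOn n a γ, l + 1, rfl, fun n hn => ?_, fun n => ?_, fun n => ?_⟩
    · cases n with
      | zero => omega
      | succ n => exact hl n (by omega)
    · cases n with
      | zero => simpa [h0] using hac.1
      | succ n => exact hs n
    · cases n with
      | zero => exact hx
      | succ n => exact hR n

namespace IsDiscreteGeodesic

theorem chainOutside_of_dist_le (hX : IsDiscreteGeodesic X) {o y : X} {R : ℝ} (m : ℕ) :
    ∀ x : X, dist x y ≤ m → R + m ≤ dist o x → ChainOutside o R x y := by
  induction m with
  | zero =>
    intro x hxy _
    have : x = y := dist_le_zero.mp (by simpa using hxy)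
    subst this
    exact .refl
  | succ m ih =>
    intro x hxy hR
    by_cases h : x = y
    · subst h
      exact .refl
    obtain ⟨z, hz, hzy⟩ := hX.step x y h
    push_cast at hxy hR
    have hoz : dist o x ≤ dist o z + 1 := by
      have := dist_triangle o z x
      rw [dist_comm z x] at this
      linarith
    have hm : (0 : ℝ) ≤ m := m.cast_nonneg
    exact .head ⟨hz.le, by linarith, by linarith⟩ (ih z (by linarith) (by linarith))

/-- When `x` lies on a geodesic from `o` to `z`, each step from `x` towards `z` increases the
distance to `o`, so the ball of radius `R` is never entered. -/
theorem chainOutside_of_dist_add (hX : IsDiscreteGeodesic X) {o z : X} {R : ℝ} (m : ℕ) :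
    ∀ x : X, dist x z = m → dist o z = dist o x + dist x z → R ≤ dist o x →
      ChainOutside o R x z := by
  induction m with
  | zero =>
    intro x hxz _ _
    have : x = z := dist_eq_zero.mp (by simpa using hxz)
    subst this
    exact .refl
  | succ m ih =>
    intro x hxz hadd hR
    by_cases h : x = z
    · subst h
      exact .refl
    obtain ⟨w, hw, hwz⟩ := hX.step x z h
    push_cast at hxz
    have h1 := dist_triangle o w z
    have h2 := dist_triangle o x w
    exact .head ⟨hw.le, hR, by linarith⟩
      (ih w (by linarith) (by linarith) (by linarith))

theorem chainOutside_zero (hX : IsDiscreteGeodesic X) (o x y : X) : ChainOutside o 0 x y := by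
  have key : ∀ z : X, ChainOutside o 0 o z := fun z => by
    obtain ⟨m, hm⟩ := hX.dist_nat o z
    exact hX.chainOutside_of_dist_add m o hm (by simp) (by simp)
  exact (key x).symm.trans (key y)

/-- König's lemma. Call `z` behind `g` if `g` lies on a geodesic from `o` to `z`. If infinitely many
points of `Z` lie behind `g`, then so they do behind one of the finitely many neighbours of `g` that
are one step farther from `o`. -/
theorem exists_geodesic_ray (hX : IsDiscreteGeodesic X) (o : X) {Z : Set X} (hZ : Z.Infinite) :
    ∃ σ : ℕ → X, (∀ n, dist o (σ n) = n) ∧ (∀ n, dist (σ n) (σ (n + 1)) = 1) ∧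
      ∀ n, ∃ z ∈ Z, dist o z = dist o (σ n) + dist (σ n) z := by
  let W : X → Set X := fun g => {z ∈ Z | dist o z = dist o g + dist g z}
  have hstep : ∀ g : X, (W g).Infinite →
      ∃ g' : X, (W g').Infinite ∧ dist g g' = 1 ∧ dist o g' = dist o g + 1 := by
    intro g hg
    by_contra! hcon
    apply hg
    have hfin : (Metric.closedBall g 1 ∩ {g' | dist g g' = 1 ∧ dist o g' = dist o g + 1}).Finite :=
      (hX.finite_closedBall g 1).subset Set.inter_subset_left
    refine ((Set.finite_singleton g).union
      (hfin.biUnion (t := W) fun g' hg' => ?_)).subset ?_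
    · by_contra hinf
      exact hcon g' hinf hg'.2.1 hg'.2.2
    · intro z hz
      by_cases hgz : g = z
      · exact Or.inl hgz.symm
      · right
        obtain ⟨w, hw, hwz⟩ := hX.step g z hgz
        have h0 := hz.2
        have h1 := dist_triangle o w z
        have h2 := dist_triangle o g w
        have how : dist o w = dist o g + 1 := by linarith
        refine Set.mem_biUnion (x := w) ⟨?_, hw, how⟩ ⟨hz.1, by linarith⟩
        rw [Metric.mem_closedBall, dist_comm, hw]
  choose! next hnext using hstep
  have ho : (W o).Infinite := by
    have : W o = Z := by ext z; simp [W]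
    rwa [this]
  let σ : ℕ → X := fun n => next^[n] o
  have hsucc : ∀ n, σ (n + 1) = next (σ n) := fun n => Function.iterate_succ_apply' next n o
  have hinf : ∀ n, (W (σ n)).Infinite := by
    intro n
    induction n with
    | zero => exact ho
    | succ n ih => rw [hsucc]; exact (hnext _ ih).1
  refine ⟨σ, fun n => ?_, fun n => ?_, fun n => ?_⟩
  · induction n with
    | zero => simp [σ]
    | succ n ih => rw [hsucc, (hnext _ (hinf n)).2.2, ih]; push_cast; ring
  · rw [hsucc]
    exact (hnext _ (hinf n)).2.1
  · obtain ⟨z, hz⟩ := (hinf n).nonempty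
    exact ⟨z, hz.1, hz.2⟩

end IsDiscreteGeodesic

theorem dist_le_of_dist_succ_le {σ : ℕ → X} {K : ℝ} (h : ∀ n, dist (σ n) (σ (n + 1)) ≤ K)
    (m n : ℕ) : dist (σ m) (σ n) ≤ K * |(m : ℝ) - n| := by
  wlog hmn : m ≤ n generalizing m n
  · rw [dist_comm, abs_sub_comm]
    exact this n m (by omega)
  have := dist_le_Ico_sum_of_dist_le (f := σ) (d := fun _ => K) hmn fun {k} _ _ => h k
  have hc : (m : ℝ) ≤ n := by exact_mod_cast hmn
  rw [abs_of_nonpos (by linarith)]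
  simp only [Finset.sum_const, Nat.card_Ico, nsmul_eq_mul, Nat.cast_sub hmn] at this
  linarith

theorem dist_ray_eq {o : X} {σ : ℕ → X} (h0 : ∀ n, dist o (σ n) = n)
    (h1 : ∀ n, dist (σ n) (σ (n + 1)) = 1) (m n : ℕ) : dist (σ m) (σ n) = |(m : ℝ) - n| := by
  refine le_antisymm (by simpa using dist_le_of_dist_succ_le (fun n => (h1 n).le) m n) ?_
  rw [← h0 m, ← h0 n, dist_comm o, dist_comm o]
  exact abs_dist_sub_le _ _ _

theorem abs_floor_sub_floor (s t : ℝ≥0) :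
    |((⌊s⌋₊ : ℝ) - ⌊t⌋₊)| ≤ dist s t + 1 ∧ dist s t - 1 ≤ |((⌊s⌋₊ : ℝ) - ⌊t⌋₊)| := by
  have hs : ((⌊s⌋₊ : ℝ)) ≤ s := by exact_mod_cast Nat.floor_le s.2
  have ht : ((⌊t⌋₊ : ℝ)) ≤ t := by exact_mod_cast Nat.floor_le t.2
  have hs' : (s : ℝ) < ⌊s⌋₊ + 1 := by exact_mod_cast Nat.lt_floor_add_one s
  have ht' : (t : ℝ) < ⌊t⌋₊ + 1 := by exact_mod_cast Nat.lt_floor_add_one t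
  rw [NNReal.dist_eq]
  have h1 := le_abs_self ((s : ℝ) - t)
  have h2 := neg_abs_le ((s : ℝ) - t)
  have h3 := le_abs_self ((⌊s⌋₊ : ℝ) - ⌊t⌋₊)
  have h4 := neg_abs_le ((⌊s⌋₊ : ℝ) - ⌊t⌋₊)
  constructor
  · rw [abs_le]
    constructor <;> linarith
  · rw [sub_le_iff_le_add, abs_le]
    constructor <;> linarith

theorem isCoarseBasepoint_of_ray {o : X} {σ : ℕ → X} (h0 : ∀ n, dist o (σ n) = n)
    (h1 : ∀ n, dist (σ n) (σ (n + 1)) = 1) : IsCoarseBasepoint fun t : ℝ≥0 => σ ⌊t⌋₊ := by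
  have hq : ∀ s t : ℝ≥0, dist (σ ⌊s⌋₊) (σ ⌊t⌋₊) ≤ dist s t + 1 ∧
      dist s t - 1 ≤ dist (σ ⌊s⌋₊) (σ ⌊t⌋₊) := fun s t => by
    rw [dist_ray_eq h0 h1]
    exact abs_floor_sub_floor s t
  refine ⟨⟨fun r hr => ⟨r + 1, by linarith, fun s t hst => ?_⟩, fun B hB => ?_⟩,
    fun t => σ ⌊t⌋₊, ⟨1, 1, le_rfl, zero_le_one, fun s t => ⟨?_, ?_⟩⟩, 0, fun t => by simp⟩
  · linarith [(hq s t).1]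
  · obtain ⟨K, hK⟩ := Metric.isBounded_iff.mp hB
    refine Metric.isBounded_iff.mpr ⟨K + 1, fun s hs t ht => ?_⟩
    linarith [(hq s t).2, hK hs ht]
  · simpa using (hq s t).2
  · simpa using (hq s t).1

end Chains

/-! ### One-endedness from coarse path-connectedness. -/

section OneEnded

variable {X : Type u} [MetricSpace X]

theorem IsProperMap.exists_dist_bound {Y : Type v} [PseudoMetricSpace Y] {f : X → Y}
    (hf : IsProperMap f) (o : X) (o' : Y) (c : ℝ) : ∃ R : ℝ, ∀ x, dist o' (f x) ≤ c → dist o x ≤ R := by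
  obtain ⟨R, hR⟩ := (Metric.isBounded_iff_subset_closedBall o).mp
    (hf (Metric.closedBall o' c) Metric.isBounded_closedBall)
  refine ⟨R, fun x hx => ?_⟩
  rw [dist_comm]
  exact hR (by simpa [dist_comm] using hx)

/-- A coarse homotopy joins the values of two rays far out by chains far out. -/
theorem CoarselyHomotopic.exists_chainOutside (hX : IsDiscreteGeodesic X) {f g : ℝ≥0 → X}
    (h : CoarselyHomotopic f g) (o : X) (R : ℝ) :
    ∃ s₀ : ℝ, ∀ s : ℝ≥0, s₀ < s → ChainOutside o R (f s) (g s) := by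
  obtain ⟨p, -, H, ⟨hc, hp⟩, hbot, htop⟩ := h
  obtain ⟨K, hK, hKs⟩ := hc 2 two_pos
  -- The margin `⌈K⌉₊` leaves room to join consecutive values of `H`, at most `K` apart, by
  -- geodesics outside the `R`-ball.
  obtain ⟨s₀, hs₀⟩ := IsProperMap.exists_dist_bound hp (Cylinder.bot p 0) o (R + ⌈K⌉₊)
  refine ⟨s₀, fun s hs => ?_⟩
  have hfar : ∀ z : Cylinder p, z.1.1 = s → R + ⌈K⌉₊ ≤ dist o (H z) := by
    intro z hz
    by_contra! hlt
    have h1 := hs₀ z hlt.le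
    have h2 : dist (0 : ℝ≥0) s ≤ dist (Cylinder.bot p 0) z := by
      rw [← hz]
      exact le_max_left (dist (0 : ℝ≥0) z.1.1) (dist (0 : ℝ≥0) z.1.2)
    rw [NNReal.dist_eq] at h2
    simp only [NNReal.coe_zero, zero_sub, abs_neg, NNReal.abs_eq] at h2
    linarith
  have hclose : ∀ z w : Cylinder p, z.1.1 = s → w.1.1 = s → dist z.1.2 w.1.2 ≤ 1 →
      ChainOutside o R (H z) (H w) := by
    intro z w hz hw hzw
    refine hX.chainOutside_of_dist_le ⌈K⌉₊ _ ?_ (hfar z hz)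
    have : dist z w < 2 := by
      have : dist z w = max (dist z.1.1 w.1.1) (dist z.1.2 w.1.2) := rfl
      rw [this, hz, hw, dist_self]
      exact max_lt two_pos (by linarith)
    exact (hKs z w this).le.trans (Nat.le_ceil K)
  -- The fibre over `s` is sampled at integer heights, truncated at its top.
  let z : ℕ → Cylinder p := fun n => ⟨(s, min n (p s)), min_le_right _ _⟩
  have hz : ∀ n : ℕ, ChainOutside o R (f s) (H (z n)) := by
    intro n
    induction n with
    | zero =>
      have : z 0 = Cylinder.bot p s := by simp [z, Cylinder.bot]
      rw [this, hbot]
      exact .refl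
    | succ n ih =>
      refine ih.trans (hclose _ _ rfl rfl ?_)
      simp only [z, NNReal.dist_eq, NNReal.coe_min, NNReal.coe_natCast]
      refine (abs_min_sub_min_le_max _ _ _ _).trans ?_
      simp
  have : z ⌈p s⌉₊ = Cylinder.top p s := by
    simp [z, Cylinder.top, Nat.le_ceil]
  have h2 := hz ⌈p s⌉₊
  rwa [this, htop] at h2

/-- Coarsely path-connected discrete geodesic spaces are one-ended. -/
theorem IsDiscreteGeodesic.exists_chainOutside_ray (hX : IsDiscreteGeodesic X)
    (hconn : IsCoarselyPathConnected X) {o : X} {ρ : ℕ → X} (h0 : ∀ n, dist o (ρ n) = n)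
    (h1 : ∀ n, dist (ρ n) (ρ (n + 1)) = 1) (R : ℝ) :
    ∃ R' : ℝ, ∀ b : X, R' < dist o b → ∃ T : ℕ, R ≤ T ∧ ChainOutside o R b (ρ T) := by
  by_contra! hcon
  let Z : Set X := {b | ∀ T : ℕ, R ≤ T → ¬ ChainOutside o R b (ρ T)}
  have hZ : Z.Infinite := by
    intro hfin
    obtain ⟨r, hr⟩ := (Metric.isBounded_iff_subset_closedBall o).mp hfin.isBounded
    obtain ⟨b, hb, hbZ⟩ := hcon r
    have := hr hbZ
    rw [Metric.mem_closedBall, dist_comm] at this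
    linarith
  -- A ray with points of `Z` behind each of its points. Its coarse homotopy to `ρ` yields a far-out
  -- chain from `σ s` to `ρ s`; extended outwards to some `z` in `Z`, it contradicts the definition
  -- of `Z`.
  obtain ⟨σ, hσ0, hσ1, hσZ⟩ := hX.exists_geodesic_ray o hZ
  obtain ⟨s₀, hs₀⟩ := (hconn _ _ (isCoarseBasepoint_of_ray hσ0 hσ1)
    (isCoarseBasepoint_of_ray h0 h1)).exists_chainOutside hX o R
  obtain ⟨s, hs⟩ := exists_nat_gt (max s₀ R)
  have hsR := (le_max_right s₀ R).trans hs.le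
  have hchain : ChainOutside o R (σ s) (ρ s) := by
    simpa using hs₀ s (by simpa using (le_max_left s₀ R).trans_lt hs)
  obtain ⟨z, hz, hadd⟩ := hσZ s
  obtain ⟨m, hm⟩ := hX.dist_nat (σ s) z
  refine hz s hsR (.trans (ChainOutside.symm ?_) hchain)
  exact hX.chainOutside_of_dist_add m _ hm hadd (by rw [hσ0]; exact hsR)

end OneEnded

/-! ### Ostrand colourings from covers of bounded multiplicity. -/

/-- Every `r`-chain in `A` has endpoints at distance at most `D`. -/
def ChainsBounded {X : Type u} [MetricSpace X] (A : Set X) (r D : ℝ) : Prop :=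
  ∀ x y : X, Relation.ReflTransGen (fun a b => a ∈ A ∧ b ∈ A ∧ dist a b < r) x y → dist x y ≤ D

section Colouring

variable {X : Type u} [MetricSpace X]

theorem infDist_sub_infDist_le_dist (x y : X) (s : Set X) :
    Metric.infDist x s - Metric.infDist y s ≤ dist x y := by
  linarith [Metric.infDist_le_infDist_add_dist (s := s) (x := x) (y := y)]

/-- Among at most `n + 1` numbers, one of which is at least `(n + 1) g`, there is a gap of length
`g` above `0`. -/
theorem exists_gap {ι : Type*} (T : Finset ι) (f : ι → ℝ) {n : ℕ} (hT : T.card ≤ n + 1) {g : ℝ}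
    (hg : 0 < g) {m : ι} (hm : m ∈ T) (hfm : (n + 1) * g ≤ f m) :
    ∃ j : ℕ, j ≤ n ∧ ∀ i ∈ T, f i ≤ j * g ∨ (j + 1) * g ≤ f i := by
  by_contra! hcon
  have : Nonempty ι := ⟨m⟩
  -- Without a gap, each of the `n + 1` disjoint intervals `(j * g, (j + 1) * g)` contains a value
  -- of `f`. With `m`, which lies beyond all of them, this gives `n + 2` elements of `T`.
  choose! e heT he1 he2 using hcon
  have hinj : Set.InjOn e (Finset.range (n + 1) : Set ℕ) := by
    have key : ∀ a b : ℕ, a ≤ n → b ≤ n → a < b → e a ≠ e b := by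
      intro a b ha hb hab heq
      have h1 := he2 a ha
      have h2 := he1 b hb
      rw [heq] at h1
      have : ((a : ℝ) + 1) ≤ b := by exact_mod_cast hab
      nlinarith
    intro a ha b hb hab
    simp only [Finset.coe_range, Set.mem_Iio] at ha hb
    rcases lt_trichotomy a b with h | h | h
    · exact absurd hab (key a b (by omega) (by omega) h)
    · exact h
    · exact absurd hab.symm (key b a (by omega) (by omega) h)
  classical
  have hsub : insert m ((Finset.range (n + 1)).image e) ⊆ T := by
    intro i hi
    rcases Finset.mem_insert.mp hi with rfl | hi
    · exact hm
    · obtain ⟨j, hj, rfl⟩ := Finset.mem_image.mp hi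
      exact heT j (by simp at hj; omega)
  have hnot : m ∉ (Finset.range (n + 1)).image e := by
    intro hi
    obtain ⟨j, hj, rfl⟩ := Finset.mem_image.mp hi
    have hj' : j ≤ n := by simp at hj; omega
    have := he2 j hj'
    have : ((j : ℝ)) ≤ n := by exact_mod_cast hj'
    nlinarith
  have := Finset.card_le_card hsub
  rw [Finset.card_insert_of_notMem hnot, Finset.card_image_of_injOn hinj, Finset.card_range] at this
  omega

/-- Ostrand's description of asymptotic dimension by coloured decompositions. -/
theorem AsdimLE.exists_coloring {n : ℕ} (h : AsdimLE X n)
    (hunb : ¬ Bornology.IsBounded (Set.univ : Set X)) {g : ℝ} (hg : 0 < g) :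
    ∃ (D : ℝ) (A : Fin (n + 1) → Set X), 0 ≤ D ∧ (∀ x, ∃ i, x ∈ A i) ∧
      ∀ i, ChainsBounded (A i) g D := by
  classical
  let R : ℝ := (n + 1) * g
  have hR : 0 < R := by positivity
  obtain ⟨𝒰, ⟨-, -, K, hK⟩, hmult, hleb⟩ := h (Set.range fun x => Metric.ball x R) ⟨by
      rintro _ ⟨x, rfl⟩
      exact Metric.isOpen_ball, Set.eq_univ_of_forall fun x =>
        ⟨_, ⟨x, rfl⟩, Metric.mem_ball_self hR⟩, 2 * R, by
      rintro _ ⟨x, rfl⟩ y hy z hz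
      rw [Metric.mem_ball] at hy hz
      linarith [dist_triangle_right y z x]⟩
  let f : Set X → X → ℝ := fun U x => Metric.infDist x Uᶜ
  have hmem : ∀ U x, 0 < f U x → x ∈ U := by
    intro U x hx
    by_contra hxU
    have : f U x = 0 := Metric.infDist_zero_of_mem hxU
    linarith
  -- Here `σ` dominates at `x`: its members are deeper at `x`, by at least `g`, than all other
  -- members of the cover. The colour of `x` is the size of a dominating family, as for vertices of
  -- the barycentric subdivision of the nerve.
  let P : Finset (Set X) → X → Prop := fun σ x =>
    ↑σ ⊆ 𝒰 ∧ ∀ U ∈ σ, g ≤ f U x ∧ ∀ V ∈ 𝒰, V ∉ σ → f V x + g ≤ f U x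
  let A : Fin (n + 1) → Set X := fun i => {x | ∃ σ, P σ x ∧ σ.card = i + 1}
  have hsep : ∀ (σ τ : Finset (Set X)) (x y : X), P σ x → P τ y → σ.card = τ.card →
      dist x y < g → σ = τ := by
    intro σ τ x y hσ hτ hcard hxy
    by_contra hne
    have h1 : ¬ σ ⊆ τ := fun hs => hne (Finset.eq_of_subset_of_card_le hs hcard.ge)
    have h2 : ¬ τ ⊆ σ := fun hs => hne (Finset.eq_of_subset_of_card_le hs hcard.le).symm
    obtain ⟨U, hU, hU'⟩ := Finset.not_subset.mp h1
    obtain ⟨V, hV, hV'⟩ := Finset.not_subset.mp h2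
    -- Between `x` and `y` the order of the depths of `U` and `V` is reversed, with margin `g` at
    -- both ends. Depth is 1-Lipschitz, so this forces `2 * g ≤ 2 * dist x y`.
    have h3 := (hσ.2 U hU).2 V (hτ.1 hV) hV'
    have h4 := (hτ.2 V hV).2 U (hσ.1 hU) hU'
    have h5 : f U x - f U y ≤ dist x y := infDist_sub_infDist_le_dist x y _
    have h6 : f V y - f V x ≤ dist y x := infDist_sub_infDist_le_dist y x _
    rw [dist_comm] at h6
    linarith
  refine ⟨max K 0, A, le_max_right _ _, fun x => ?_, fun i x y hxy => ?_⟩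
  · obtain ⟨W, hW, hWx⟩ := hleb _ ⟨x, rfl⟩
    -- `Metric.infDist` to the empty set is `0`, so the depth would be meaningless for `W = univ`;
    -- unboundedness of `X` excludes this.
    have hWne : (Wᶜ).Nonempty := by
      rw [Set.nonempty_compl]
      rintro rfl
      exact hunb (Metric.isBounded_iff.mpr ⟨K, fun a ha b hb => hK _ hW a ha b hb⟩)
    have hfW : R ≤ f W x := by
      refine (Metric.le_infDist hWne).mpr fun y hy => ?_
      by_contra! hlt
      exact hy (hWx (by rwa [Metric.mem_ball, dist_comm]))
    have hfin : {U ∈ 𝒰 | x ∈ U}.Finite := by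
      refine Set.finite_of_encard_le_coe (k := n + 1) ?_
      exact_mod_cast hmult x
    have hcard : hfin.toFinset.card ≤ n + 1 := by
      have := hmult x
      rw [hfin.encard_eq_coe_toFinset_card] at this
      exact_mod_cast this
    have hWT : W ∈ hfin.toFinset := by
      simpa using ⟨hW, hmem W x (hR.trans_le hfW)⟩
    obtain ⟨j, hj, hgap⟩ := exists_gap hfin.toFinset (fun U => f U x) hcard hg hWT hfW
    let σ := hfin.toFinset.filter fun U => (j + 1) * g ≤ f U x
    have hjR : ((j : ℝ) + 1) * g ≤ R := by
      have : (j : ℝ) ≤ n := by exact_mod_cast hj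
      exact mul_le_mul_of_nonneg_right (by linarith) hg.le
    have hWσ : W ∈ σ := Finset.mem_filter.mpr ⟨hWT, hjR.trans hfW⟩
    have hpos : 0 < σ.card := Finset.card_pos.mpr ⟨W, hWσ⟩
    have hle : σ.card ≤ n + 1 := (Finset.card_filter_le _ _).trans hcard
    have hj0 : (0 : ℝ) ≤ j * g := by positivity
    refine ⟨⟨σ.card - 1, by omega⟩, σ, ⟨fun U hU => ?_, fun U hU => ⟨?_, fun V hV hVσ => ?_⟩⟩, ?_⟩
    · have := (Finset.mem_filter.mp hU).1
      simp only [Set.Finite.mem_toFinset, Set.mem_ofPred_eq] at this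
      exact this.1
    · have := (Finset.mem_filter.mp hU).2
      linarith
    · have hU' := (Finset.mem_filter.mp hU).2
      have hV' : f V x ≤ j * g := by
        by_cases hxV : x ∈ V
        · have hVT : V ∈ hfin.toFinset := by simpa using ⟨hV, hxV⟩
          rcases hgap V hVT with h | h
          · exact h
          · exact absurd (Finset.mem_filter.mpr ⟨hVT, h⟩) hVσ
        · have : f V x = 0 := Metric.infDist_zero_of_mem hxV
          linarith
      linarith
    · simp only
      omega
  · rcases Relation.ReflTransGen.cases_head hxy with rfl | ⟨c, hxc, -⟩
    · simp
    obtain ⟨σ, hσ, hσi⟩ := hxc.1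
    -- By `hsep` the dominating family is constant along the chain, so both endpoints lie in one
    -- member of the cover.
    have key : P σ y := by
      clear hxc
      induction hxy with
      | refl => exact hσ
      | tail _ hbc ih =>
        obtain ⟨τ, hτ, hτi⟩ := hbc.2.1
        rwa [hsep σ τ _ _ ih hτ (hσi.trans hτi.symm) hbc.2.2]
    obtain ⟨U, hU⟩ := Finset.card_pos.mp (show 0 < σ.card by omega)
    exact (hK U (hσ.1 hU) x (hmem U x (hg.trans_le (hσ.2 U hU).1)) y
      (hmem U y (hg.trans_le (key.2 U hU).1))).trans (le_max_left _ _)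

end Colouring

/-! ### Dividing the space into concentric shells. -/

section Levels

variable {X : Type u} [MetricSpace X]

/-- A level function growing slowly with the distance to `o`. -/
theorem exists_level (o : X) {F : ℕ → ℝ} (hF : Monotone F) (hF1 : ∀ k, 1 ≤ F k) {M : ℝ}
    (hM : 2 ≤ M) :
    ∃ lev : X → ℕ, (∀ k, ∃ R : ℝ, ∀ x, R ≤ dist o x → k ≤ lev x) ∧
      (∀ x, 1 ≤ lev x → M * F (lev x) ≤ dist o x) ∧
      ∀ x, ∃ k ≤ lev x, ∀ y, dist x y ≤ F (lev x) → lev y = k ∨ lev y = k + 1 := by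
  -- Level `k` is the shell between the radii `R k` and `R (k + 1)`. Its width `M * F (k + 1)` is at
  -- least twice `F k`, so a ball of radius `F k` centred in it cannot cross both boundaries.
  let R : ℕ → ℝ := fun k => Nat.rec 0 (fun k a => a + M * F (k + 1)) k
  have hsucc : ∀ k, R (k + 1) = R k + M * F (k + 1) := fun _ => rfl
  have hMF : ∀ k, 2 * F k ≤ M * F k := fun k =>
    mul_le_mul_of_nonneg_right hM (by linarith [hF1 k])
  have hmono : Monotone R := monotone_nat_of_le_succ fun k => by
    linarith [hsucc k, hMF (k + 1), hF1 (k + 1)]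
  have hge : ∀ k : ℕ, (k : ℝ) ≤ R k := by
    intro k
    induction k with
    | zero => simp [R]
    | succ k ih => push_cast; linarith [hsucc k, hMF (k + 1), hF1 (k + 1)]
  have hex : ∀ x : X, ∃ k, dist o x < R (k + 1) := fun x => by
    obtain ⟨k, hk⟩ := exists_nat_gt (dist o x)
    exact ⟨k, hk.trans_le ((hge k).trans (hmono k.le_succ))⟩
  classical
  let lev : X → ℕ := fun x => Nat.find (hex x)
  have hlt : ∀ x, dist o x < R (lev x + 1) := fun x => Nat.find_spec (hex x)
  have hle : ∀ x, R (lev x) ≤ dist o x := fun x => by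
    rcases Nat.eq_zero_or_pos (lev x) with h | h
    · rw [h]
      exact dist_nonneg
    · have := Nat.find_min (hex x) (m := lev x - 1) (Nat.sub_lt h one_pos)
      rw [show lev x - 1 + 1 = lev x by omega] at this
      exact not_lt.mp this
  have hlev1 : ∀ x k, R k ≤ dist o x → k ≤ lev x := fun x k hk => by
    by_contra! hcon
    exact absurd (hlt x) (not_lt.mpr ((hmono hcon).trans hk))
  have hlev2 : ∀ x k, dist o x < R (k + 1) → lev x ≤ k := fun x k hk => by
    by_contra! hcon
    exact absurd hk (not_lt.mpr ((hmono hcon).trans (hle x)))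
  refine ⟨lev, fun k => ⟨R k, fun x hx => hlev1 x k hx⟩, fun x hx => ?_, fun x => ?_⟩
  · obtain ⟨m, hm⟩ := Nat.exists_eq_succ_of_ne_zero (show lev x ≠ 0 by omega)
    have h1 := hle x
    rw [hm, Nat.succ_eq_add_one] at h1 ⊢
    have h0 : (0 : ℝ) ≤ R m := (Nat.cast_nonneg m).trans (hge m)
    linarith [hsucc m]
  · have hF2 := hMF (lev x + 1)
    have hF3 := hF (Nat.le_succ (lev x))
    rw [Nat.succ_eq_add_one] at hF3
    by_cases hx : R (lev x) + F (lev x) ≤ dist o x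
    · refine ⟨lev x, le_rfl, fun y hy => ?_⟩
      have h1 := dist_triangle o y x
      have h2 := dist_triangle o x y
      rw [dist_comm y x] at h1
      have h3 := hlev1 y (lev x) (by linarith)
      have h4 := hlev2 y (lev x + 1) (by
        have := hMF (lev x + 1 + 1)
        have := hF (Nat.le_succ (lev x + 1))
        rw [Nat.succ_eq_add_one] at this
        linarith [hlt x, hsucc (lev x + 1), hF1 (lev x)])
      omega
    · push Not at hx
      -- Close to the inner boundary the ball can only reach inwards. At level `0` the subtraction
      -- truncates, harmlessly, because then `lev y = 0`.
      refine ⟨lev x - 1, Nat.sub_le _ _, fun y hy => ?_⟩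
      have h1 := dist_triangle o y x
      have h2 := dist_triangle o x y
      rw [dist_comm y x] at h1
      have h4 := hlev2 y (lev x) (by linarith [hsucc (lev x)])
      have h3 := hlev1 y (lev x - 1) (by
        rcases Nat.eq_zero_or_pos (lev x) with h | h
        · rw [h]
          exact dist_nonneg
        · have := hsucc (lev x - 1)
          rw [Nat.sub_add_cancel h] at this
          linarith [hle x, hMF (lev x), hF1 (lev x)])
      omega

end Levels

/-! ### Gluing colourings of growing scale into collapsible sets. -/

section Collapse

variable {X : Type u} [MetricSpace X]

/-- A set which far away from `o` is a union of pieces with distances tending to infinity, the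
pieces being the fibres of `β`, and each piece being small compared to its distance to `o`. -/
structure IsCollapse (o : X) (M : ℝ) (A : Set X) (β : X → X) : Prop where
  separated : ∀ r : ℝ, ∃ R : ℝ, ∀ x ∈ A, ∀ y ∈ A, R ≤ dist o x → dist x y < r → β x = β y
  small : ∃ R : ℝ, ∀ x ∈ A, R ≤ dist o x → M * dist x (β x) ≤ dist o x

/-- The steps allowed in a set which at level `k` is given by `U k` with scale `r k`. -/
def LevelStep (lev : X → ℕ) (U : ℕ → Set X) (r : ℕ → ℝ) (a b : X) : Prop :=
  a ∈ U (lev a) ∧ b ∈ U (lev b) ∧ dist a b < r (min (lev a) (lev b))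

/-- Chains that start in a region with only two consecutive levels are bounded. -/
theorem dist_le_of_levelStep_chain {lev : X → ℕ} {U : ℕ → Set X} {r D : ℕ → ℝ}
    (hr : ∀ k, 1 ≤ r k) (hD : ∀ k, 0 ≤ D k) (hrD : ∀ k, D k + 2 * r k ≤ r (k + 1))
    (hU : ∀ k, ChainsBounded (U k) (r k) (D k)) {x : X} (hx : x ∈ U (lev x)) {k : ℕ}
    (hk : ∀ y, dist x y ≤ 4 * r (k + 2) → lev y = k ∨ lev y = k + 1) {y : X}
    (hxy : Relation.ReflTransGen (LevelStep lev U r) x y) : dist x y ≤ 3 * r (k + 2) := by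
  let S : ℕ → X → X → Prop := fun j a b => a ∈ U j ∧ b ∈ U j ∧ dist a b < r j
  -- Either the chain has stayed at level `k`, or it entered level `k + 1` at `q₀` and was last
  -- there at `q`. In the second case it is now at `q` or on an excursion at level `k` starting at
  -- `p`.
  let Inv : X → Prop := fun y => (lev y = k ∧ Relation.ReflTransGen (S k) x y) ∨
    ∃ q₀ q, dist x q₀ ≤ D k + r k ∧ q ∈ U (k + 1) ∧ Relation.ReflTransGen (S (k + 1)) q₀ q ∧
      ((lev y = k + 1 ∧ y = q) ∨
        (lev y = k ∧ ∃ p, dist q p < r k ∧ Relation.ReflTransGen (S k) p y))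
  have h1 := hr k
  have h2 := hr (k + 1)
  have h3 := hD k
  have h4 := hD (k + 1)
  have h5 := hrD k
  have h6 : D (k + 1) + 2 * r (k + 1) ≤ r (k + 2) := hrD (k + 1)
  have bound : ∀ y, Inv y → dist x y ≤ 3 * r (k + 2) := by
    rintro y (⟨-, h⟩ | ⟨q₀, q, h0, -, hq, ⟨-, rfl⟩ | ⟨-, p, hqp, hp⟩⟩)
    · linarith [hU _ _ _ h]
    · linarith [hU _ _ _ hq, dist_triangle x q₀ y]
    · linarith [hU _ _ _ hq, hU _ _ _ hp, dist_triangle x q₀ y, dist_triangle q₀ q y,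
        dist_triangle q p y]
  refine bound y ?_
  induction hxy with
  | refl =>
    rcases hk x (by rw [dist_self]; linarith) with h | h
    · exact Or.inl ⟨h, .refl⟩
    · refine Or.inr ⟨x, x, by rw [dist_self]; linarith, h ▸ hx, .refl, Or.inl ⟨h, rfl⟩⟩
  | @tail y z _ hyz ih =>
    obtain ⟨hy, hz, hlt⟩ := hyz
    have hyk : lev y = k ∨ lev y = k + 1 := hk y ((bound y ih).trans (by linarith))
    have hd : dist y z < r (k + 2) := by
      have hle : r (min (lev y) (lev z)) ≤ r (k + 1) := by
        have hmono : Monotone r := monotone_nat_of_le_succ fun j => by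
          linarith [hD j, hrD j, hr j]
        exact hmono ((min_le_left _ _).trans (by omega))
      linarith
    have hzk : lev z = k ∨ lev z = k + 1 := hk z (by
      linarith [bound y ih, dist_triangle x y z])
    rcases ih with ⟨hyl, h⟩ | ⟨q₀, q, h0, hqU, hq, ⟨hyl, rfl⟩ | ⟨hyl, p, hqp, hp⟩⟩
    · rw [hyl] at hy hlt
      rcases hzk with hzl | hzl <;> rw [hzl] at hz hlt
      · rw [min_self] at hlt
        exact Or.inl ⟨hzl, h.tail ⟨hy, hz, hlt⟩⟩
      · rw [min_eq_left (Nat.le_succ k)] at hlt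
        exact Or.inr ⟨z, z, by linarith [hU _ _ _ h, dist_triangle x y z], hz, .refl,
          Or.inl ⟨hzl, rfl⟩⟩
    · rw [hyl] at hy hlt
      rcases hzk with hzl | hzl <;> rw [hzl] at hz hlt
      · rw [min_eq_right (Nat.le_succ k)] at hlt
        exact Or.inr ⟨q₀, y, h0, hqU, hq, Or.inr ⟨hzl, z, hlt, .refl⟩⟩
      · rw [min_self] at hlt
        exact Or.inr ⟨q₀, z, h0, hz, hq.tail ⟨hy, hz, hlt⟩, Or.inl ⟨hzl, rfl⟩⟩
    · rw [hyl] at hy hlt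
      rcases hzk with hzl | hzl <;> rw [hzl] at hz hlt
      · rw [min_self] at hlt
        exact Or.inr ⟨q₀, q, h0, hqU, hq, Or.inr ⟨hzl, p, hqp, hp.tail ⟨hy, hz, hlt⟩⟩⟩
      · rw [min_eq_left (Nat.le_succ k)] at hlt
        -- A completed excursion has endpoints less than `D k + 2 * r k ≤ r (k + 1)` apart, so it
        -- counts as a single step at level `k + 1`.
        refine Or.inr ⟨q₀, z, h0, hz, hq.tail ⟨hqU, hz, ?_⟩, Or.inl ⟨hzl, rfl⟩⟩
        linarith [hU _ _ _ hp, dist_triangle q p z, dist_triangle p y z]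

/-- The collapse of the set with level sets `U k` onto representatives of its pieces. -/
theorem exists_isCollapse_of_levels {o : X} {lev : X → ℕ} {U : ℕ → Set X} {r D : ℕ → ℝ} {M : ℝ}
    (hM : 2 ≤ M) (hr : ∀ k : ℕ, k + 1 ≤ r k) (hD : ∀ k, 0 ≤ D k)
    (hrD : ∀ k, D k + 2 * r k ≤ r (k + 1))
    (hU : ∀ k, ChainsBounded (U k) (r k) (D k))
    (hlev : ∀ k, ∃ R : ℝ, ∀ x, R ≤ dist o x → k ≤ lev x)
    (hlevM : ∀ x, 1 ≤ lev x → M * (4 * r (lev x + 2)) ≤ dist o x)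
    (hlev2 : ∀ x, ∃ k ≤ lev x, ∀ y, dist x y ≤ 4 * r (lev x + 2) → lev y = k ∨ lev y = k + 1) :
    ∃ β, IsCollapse o M {x | x ∈ U (lev x)} β := by
  have hr1 : ∀ k, 1 ≤ r k := fun k => by linarith [hr k, (Nat.cast_nonneg k : (0 : ℝ) ≤ k)]
  have hmono : Monotone r := monotone_nat_of_le_succ fun k => by linarith [hrD k, hr1 k, hD k]
  let s : Setoid X :=
    { r := Relation.ReflTransGen (LevelStep lev U r)
      iseqv :=
        { refl := fun _ => .refl
          symm := fun h => by
            induction h with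
            | refl => exact .refl
            | tail _ hbc ih =>
              exact .head ⟨hbc.2.1, hbc.1, by rw [dist_comm, min_comm]; exact hbc.2.2⟩ ih
          trans := .trans } }
  -- The pieces are the chain components, and `β` selects a representative of each.
  refine ⟨fun x => (Quotient.mk s x).out, fun t => ?_, ?_⟩
  · obtain ⟨k, hk⟩ := exists_nat_gt t
    obtain ⟨R, hR⟩ := hlev k
    refine ⟨R + t, fun x hx y hy hRx hxy => ?_⟩
    have ht : 0 ≤ t := dist_nonneg.trans hxy.le
    have hmin : k ≤ min (lev x) (lev y) :=
      le_min (hR x (by linarith)) (hR y (by linarith [dist_triangle_right o x y]))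
    have : Quotient.mk s x = Quotient.mk s y := Quotient.sound (.single ⟨hx, hy, by
      linarith [hr k, hmono hmin]⟩)
    simp only [this]
  · obtain ⟨R, hR⟩ := hlev 1
    refine ⟨R, fun x hx hRx => ?_⟩
    have hchain : Relation.ReflTransGen (LevelStep lev U r) x (Quotient.mk s x).out :=
      s.iseqv.symm (Quotient.mk_out (s := s) x)
    obtain ⟨k, hk, hk2⟩ := hlev2 x
    have hle : r (k + 2) ≤ r (lev x + 2) := hmono (by omega)
    have hd := dist_le_of_levelStep_chain hr1 hD hrD hU hx
      (fun y hy => hk2 y (by linarith)) hchain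
    have := hlevM x (hR x hRx)
    have h4 := mul_le_mul_of_nonneg_left (hd.trans (by linarith [hr1 (lev x + 2)] :
      _ ≤ 4 * r (lev x + 2))) (by linarith : 0 ≤ M)
    linarith

/-- A space of asymptotic dimension at most `n` is covered by `n + 1` collapsible sets. -/
theorem AsdimLE.exists_collapse_cover {n : ℕ} (h : AsdimLE X n)
    (hunb : ¬ Bornology.IsBounded (Set.univ : Set X)) (o : X) {M : ℝ} (hM : 2 ≤ M) :
    ∃ A : Fin (n + 1) → Set X, (∀ x, ∃ i, x ∈ A i) ∧ ∀ i, ∃ β, IsCollapse o M (A i) β := by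
  have hcol : ∀ g : {g : ℝ // 0 < g}, ∃ (D : ℝ) (A : Fin (n + 1) → Set X), 0 ≤ D ∧
      (∀ x, ∃ i, x ∈ A i) ∧ ∀ i, ChainsBounded (A i) (g : ℝ) D :=
    fun g => h.exists_coloring hunb g.2
  choose D A hD hA hAb using hcol
  -- Each scale exceeds the diameter bound of the preceding colouring plus twice its scale, so that
  -- excursions one level down are absorbed.
  let t : ℕ → {g : ℝ // 0 < g} := fun k =>
    Nat.rec (motive := fun _ => {g : ℝ // 0 < g}) ⟨1, one_pos⟩
      (fun _ g => ⟨D g + 2 * g.1 + 1, by linarith [hD g, g.2]⟩) k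
  let r : ℕ → ℝ := fun k => (t k).1
  have hsucc : ∀ k, r (k + 1) = D (t k) + 2 * r k + 1 := fun _ => rfl
  have hr : ∀ k : ℕ, (k : ℝ) + 1 ≤ r k := by
    intro k
    induction k with
    | zero => simp [r, t]
    | succ k ih => push_cast; linarith [hsucc k, hD (t k), (Nat.cast_nonneg k : (0 : ℝ) ≤ k)]
  have hr1 : ∀ k, 1 ≤ r k := fun k => by
    linarith [hr k, (Nat.cast_nonneg k : (0 : ℝ) ≤ k)]
  have hmono : Monotone r := monotone_nat_of_le_succ fun k => by
    linarith [hsucc k, hr1 k, hD (t k)]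
  obtain ⟨lev, h1, h2, h3⟩ := exists_level o (F := fun k => 4 * r (k + 2))
    (fun a b hab => by
      have := hmono (show a + 2 ≤ b + 2 by omega)
      simp only
      linarith)
    (fun k => by linarith [hr1 (k + 2)]) hM
  refine ⟨fun i => {x | x ∈ A (t (lev x)) i}, fun x => hA (t (lev x)) x, fun i => ?_⟩
  exact exists_isCollapse_of_levels (U := fun k => A (t k) i) (D := fun k => D (t k))
    (r := r) hM hr (fun k => hD _) (fun k => by linarith [hsucc k])
    (fun k => hAb _ i) h1 h2 h3

end Collapse

section Properness

theorem isProperMap_of_bound {X : Type u} {Y : Type v} [PseudoMetricSpace X] [PseudoMetricSpace Y]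
    {f : X → Y} (o : X) (o' : Y)
    (h : ∀ c : ℝ, ∃ R : ℝ, ∀ x, dist o' (f x) ≤ c → dist o x ≤ R) : IsProperMap f := by
  intro B hB
  obtain ⟨c, hc⟩ := (Metric.isBounded_iff_subset_closedBall o').mp hB
  obtain ⟨R, hR⟩ := h c
  refine (Metric.isBounded_iff_subset_closedBall o).mpr ⟨R, fun x hx => ?_⟩
  rw [Metric.mem_closedBall, dist_comm]
  exact hR x (by rw [dist_comm]; exact hc hx)

end Properness

/-! ### Estimates for the bicombing, and paths to a ray. -/

section Bicombing

variable {X : Type u} [MetricSpace X]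

/-- The linear bound follows by moving the endpoint from `p` to `x` in unit steps: the combing path
is constant for endpoint `p`, and each step displaces it by at most `L`. -/
theorem IsDiscreteGeodesic.exists_bicombing_bound (hX : IsDiscreteGeodesic X)
    {C : X → X → ℕ → X} (hC : IsBicombing C) :
    ∃ L : ℝ, 1 ≤ L ∧ (∀ p x n, dist (C p x n) (C p x (n + 1)) ≤ L) ∧
      ∀ p x n, dist p (C p x n) ≤ L * dist p x := by
  obtain ⟨s, hs, hCs⟩ := hC.controlled 2 two_pos
  have hmax : ∀ (p x x' : X) (n n' : ℕ), dist x x' ≤ 1 → dist n n' ≤ 1 →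
      dist (C p x n) (C p x' n') ≤ max s 1 := by
    intro p x x' n n' hx hn
    refine (hCs (p, x, n) (p, x', n') ?_).le.trans (le_max_left _ _)
    simp only [Prod.dist_eq, dist_self]
    exact max_lt two_pos (max_lt (by linarith) (by linarith))
  refine ⟨max s 1, le_max_right _ _, fun p x n => hmax p x x n (n + 1) (by simp) (by
    simp [Nat.dist_eq]), fun p x n => ?_⟩
  obtain ⟨m, hm⟩ := hX.dist_nat p x
  induction m generalizing x with
  | zero =>
    have : p = x := dist_eq_zero.mp (by simpa using hm)
    subst this
    simp [hC.const]
  | succ m ih =>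
    have hne : x ≠ p := by
      rintro rfl
      rw [dist_self] at hm
      push_cast at hm
      linarith [(Nat.cast_nonneg m : (0 : ℝ) ≤ m)]
    obtain ⟨z, hz, hzp⟩ := hX.step x p hne
    rw [dist_comm x p, dist_comm z p] at hzp
    push_cast at hm
    have h1 := ih z (by linarith)
    have h2 := hmax p z x n n (by rw [dist_comm]; exact hz.le) (by simp)
    rw [hzp]
    linarith [dist_triangle p (C p z n) (C p x n)]

/-- In a one-ended space, points far out are joined to a ray by paths far out. -/
theorem IsDiscreteGeodesic.exists_paths_to_ray (hX : IsDiscreteGeodesic X)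
    (hconn : IsCoarselyPathConnected X) {o : X} {ρ : ℕ → X} (h0 : ∀ n, dist o (ρ n) = n)
    (h1 : ∀ n, dist (ρ n) (ρ (n + 1)) = 1) :
    ∃ (T l : X → ℕ) (γ : X → ℕ → X), (∀ b, γ b 0 = b) ∧ (∀ b n, l b ≤ n → γ b n = ρ (T b)) ∧
      (∀ b n, dist (γ b n) (γ b (n + 1)) ≤ 1) ∧
      ∀ R : ℝ, ∃ R' : ℝ, ∀ b, R' ≤ dist o b → R ≤ T b ∧ ∀ n, R ≤ dist o (γ b n) := by
  classical
  let P : X → ℕ → Prop := fun b k =>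
    (k : ℝ) ≤ dist o b ∧ ∃ T : ℕ, (k : ℝ) ≤ T ∧ ChainOutside o k b (ρ T)
  have hP0 : ∀ b, P b 0 := fun b => ⟨by simp, 0, by simp, by
    simpa using hX.chainOutside_zero o b (ρ 0)⟩
  -- The path from `b` is chosen to avoid the largest possible ball. One-endedness says exactly that
  -- this radius tends to infinity with `b`.
  let K : X → ℕ := fun b => Nat.findGreatest (P b) ⌊dist o b⌋₊
  have hK : ∀ b, P b (K b) := fun b => Nat.findGreatest_spec (Nat.zero_le _) (hP0 b)
  have hpath : ∀ b, ∃ (T l : ℕ) (γ : ℕ → X), γ 0 = b ∧ (∀ n, l ≤ n → γ n = ρ T) ∧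
      (∀ n, dist (γ n) (γ (n + 1)) ≤ 1) ∧ (K b : ℝ) ≤ T ∧ ∀ n, K b ≤ dist o (γ n) := by
    intro b
    obtain ⟨hb, T, hT, hch⟩ := hK b
    obtain ⟨γ, l, h0, hl, hs, hR⟩ := hch.exists_path hb
    exact ⟨T, l, γ, h0, hl, hs, hT, hR⟩
  choose T l γ hγ0 hγl hγs hγT hγR using hpath
  refine ⟨T, l, γ, hγ0, hγl, hγs, fun R => ?_⟩
  obtain ⟨R', hR'⟩ := hX.exists_chainOutside_ray hconn h0 h1 (⌈R⌉₊ : ℝ)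
  refine ⟨max (R' + 1) ⌈R⌉₊, fun b hb => ?_⟩
  have hbR : (⌈R⌉₊ : ℝ) ≤ dist o b := (le_max_right _ _).trans hb
  have hKR : ⌈R⌉₊ ≤ K b := Nat.le_findGreatest (Nat.le_floor hbR)
    ⟨hbR, hR' b (by linarith [(le_max_left (R' + 1) (⌈R⌉₊ : ℝ)).trans hb])⟩
  have hRK : R ≤ K b := (Nat.le_ceil R).trans (by exact_mod_cast hKR)
  exact ⟨hRK.trans (hγT b), fun n => hRK.trans (hγR b n)⟩

end Bicombing

/-! ### Collapsible sets are coarsely categorical. -/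

section Categorical

variable {X : Type u} [MetricSpace X]

namespace IsCollapse

variable {o : X} {M : ℝ} {A : Set X} {β : X → X}

theorem exists_bound (hβ : IsCollapse o M A β) (hM : 2 ≤ M) (R : ℝ) :
    ∃ R' : ℝ, ∀ x ∈ A, R' ≤ dist o x → R ≤ dist o (β x) := by
  obtain ⟨R₀, hR₀⟩ := hβ.small
  refine ⟨max R₀ (2 * R), fun x hx hRx => ?_⟩
  have h1 := hR₀ x hx ((le_max_left _ _).trans hRx)
  have h2 := (le_max_right _ _).trans hRx
  have h3 := dist_triangle_right o x (β x)
  have h4 := mul_le_mul_of_nonneg_right hM (dist_nonneg (x := x) (y := β x))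
  linarith

theorem isBounded_fibre (hβ : IsCollapse o M A β) (hM : 2 ≤ M) (b : X) :
    Bornology.IsBounded {x | x ∈ A ∧ β x = b} := by
  obtain ⟨R, hR⟩ := hβ.exists_bound hM (dist o b + 1)
  refine (Metric.isBounded_iff_subset_closedBall o).mpr ⟨R, fun x hx => ?_⟩
  rw [Metric.mem_closedBall, dist_comm]
  by_contra! hlt
  have := hR x hx.1 hlt.le
  rw [hx.2] at this
  linarith

/-- Near pairs of points either lie in the same piece or in a fixed finite set. -/
theorem exists_finite (hX : IsDiscreteGeodesic X) (hβ : IsCollapse o M A β) (r : ℝ) :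
    ∃ F : Set X, F.Finite ∧ ∀ x ∈ A, ∀ y ∈ A, dist x y < r → β x = β y ∨ (x ∈ F ∧ y ∈ F) := by
  obtain ⟨R, hR⟩ := hβ.separated r
  refine ⟨Metric.closedBall o R ∪ Metric.closedBall o (R + r),
    (hX.finite_closedBall _ _).union (hX.finite_closedBall _ _), fun x hx y hy hxy => ?_⟩
  by_cases hRx : R ≤ dist o x
  · exact Or.inl (hR x hx y hy hRx hxy)
  · push Not at hRx
    refine Or.inr ⟨Or.inl ?_, Or.inr ?_⟩
    · rw [Metric.mem_closedBall, dist_comm]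
      exact hRx.le
    · rw [Metric.mem_closedBall, dist_comm]
      linarith [dist_triangle o x y]

/-- Functions of the piece that tend to infinity are coarse. -/
theorem isCoarse_comp (hX : IsDiscreteGeodesic X) (hβ : IsCollapse o M A β) (hM : 2 ≤ M)
    (a₀ : A) (q : X → ℕ) (hq : ∀ c : ℝ, ∃ R : ℝ, ∀ b, R ≤ dist o b → c ≤ q b) :
    IsCoarse fun a : A => (q (β a) : ℝ≥0) := by
  constructor
  · intro r hr
    obtain ⟨F, hF, hFβ⟩ := hβ.exists_finite hX r
    obtain ⟨m, hm⟩ := (hF.image fun x => q (β x)).bddAbove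
    refine ⟨m + 1, by positivity, fun x y hxy => ?_⟩
    rw [NNReal.dist_eq, NNReal.coe_natCast, NNReal.coe_natCast]
    rcases hFβ x x.2 y y.2 hxy with h | ⟨h1, h2⟩
    · rw [h]
      simp only [sub_self, abs_zero]
      positivity
    · have h3 : (q (β x) : ℝ) ≤ m := by exact_mod_cast hm (Set.mem_image_of_mem _ h1)
      have h4 : (q (β y) : ℝ) ≤ m := by exact_mod_cast hm (Set.mem_image_of_mem _ h2)
      have h5 : (0 : ℝ) ≤ q (β x) := Nat.cast_nonneg _
      have h6 : (0 : ℝ) ≤ q (β y) := Nat.cast_nonneg _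
      rw [abs_lt]
      constructor <;> linarith
  · refine isProperMap_of_bound a₀ 0 fun c => ?_
    obtain ⟨R, hR⟩ := hq (c + 1)
    obtain ⟨R', hR'⟩ := hβ.exists_bound hM R
    refine ⟨dist (a₀ : X) o + R', fun x hx => ?_⟩
    by_contra! hlt
    have h1 : dist (a₀ : X) x ≤ dist (a₀ : X) o + dist o (x : X) := dist_triangle _ _ _
    have h2 : dist a₀ x = dist (a₀ : X) x := rfl
    have h3 := hR _ (hR' x x.2 (by linarith))
    rw [NNReal.dist_eq] at hx
    simp only [NNReal.coe_zero, NNReal.coe_natCast, zero_sub, abs_neg, Nat.abs_cast] at hx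
    linarith

/-- A collapsible subset of a bicombable one-ended space is coarsely categorical. -/
theorem isCoarselyCategorical (hX : IsDiscreteGeodesic X) {C : X → X → ℕ → X}
    (hC : IsBicombing C) {L : ℝ} (hL : 1 ≤ L) (hLstep : ∀ p x n, dist (C p x n) (C p x (n + 1)) ≤ L)
    (hLdist : ∀ p x n, dist p (C p x n) ≤ L * dist p x)
    (hconn : IsCoarselyPathConnected X) [Infinite X]
    (hβ : IsCollapse o M A β) (hM : 2 * (1 + L) ≤ M) :
    IsCoarselyCategorical A := by
  have hM2 : 2 ≤ M := by linarith
  obtain ⟨ρ, hρ0, hρ1, -⟩ := hX.exists_geodesic_ray o (Set.infinite_univ (α := X))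
  have hρ : IsCoarse fun t : ℝ≥0 => ρ ⌊t⌋₊ := (isCoarseBasepoint_of_ray hρ0 hρ1).1
  obtain ⟨T, l, γ, hγ0, hγl, hγs, hγ⟩ := hX.exists_paths_to_ray hconn hρ0 hρ1
  choose N hN using fun b => hC.finish b _ (hβ.isBounded_fibre hM2 b)
  rcases A.eq_empty_or_nonempty with rfl | ⟨a₀, ha₀⟩
  · refine ⟨_, fun _ => 0, hρ, ?_, fun _ => 0, ?_, fun z => z.1.1, ?_, fun x => x.2.elim,
      fun x => x.2.elim⟩
    · exact ⟨fun r hr => ⟨1, one_pos, fun x => x.2.elim⟩, fun B _ => by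
        rw [Set.eq_empty_of_isEmpty (_ ⁻¹' B)]; exact Bornology.isBounded_empty⟩
    · exact ⟨fun r hr => ⟨1, one_pos, fun x => x.2.elim⟩, fun B _ => by
        rw [Set.eq_empty_of_isEmpty (_ ⁻¹' B)]; exact Bornology.isBounded_empty⟩
    · exact ⟨fun r hr => ⟨1, one_pos, fun x => x.1.1.2.elim⟩, fun B _ => by
        rw [Set.eq_empty_of_forall_notMem (s := _ ⁻¹' B) fun x => x.1.1.2.elim]
        exact Bornology.isBounded_empty⟩
  -- the length of the homotopy on the piece of `b`
  let q : X → ℕ := fun b => N b + l b + ⌈dist o b⌉₊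
  have hqc : IsCoarse fun a : A => (q (β a) : ℝ≥0) :=
    hβ.isCoarse_comp hX hM2 ⟨a₀, ha₀⟩ q fun c => ⟨c, fun b hb => by
      have := Nat.le_ceil (dist o b)
      simp only [q]
      push_cast
      linarith [(Nat.cast_nonneg (N b) : (0 : ℝ) ≤ N b), (Nat.cast_nonneg (l b) : (0 : ℝ) ≤ l b)]⟩
  have hjc : IsCoarse fun a : A => (T (β a) : ℝ≥0) :=
    hβ.isCoarse_comp hX hM2 ⟨a₀, ha₀⟩ T fun c => by
      obtain ⟨R, hR⟩ := hγ c
      exact ⟨R, fun b hb => (hR b hb).1⟩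
  -- The combing path from `β x` is run backwards for time `N (β x)`, then `γ` leads from `β x` to
  -- the ray. The durations depend only on the piece.
  let G : X → ℕ → X := fun x n =>
    if n ≤ N (β x) then C (β x) x (N (β x) - n) else γ (β x) (n - N (β x))
  have hG0 : ∀ x ∈ A, G x 0 = x := fun x hx => by
    simp only [G, Nat.zero_le, if_true, Nat.sub_zero]
    exact hN (β x) _ le_rfl x ⟨hx, rfl⟩
  have hGtop : ∀ x, G x (q (β x)) = ρ (T (β x)) := fun x => by
    simp only [G, q]
    split_ifs with h
    -- If the homotopy ends during the combing phase, then `l (β x) = 0` and `β x` is already on the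
    -- ray.
    · have hl : l (β x) ≤ 0 := by omega
      rw [show N (β x) - (N (β x) + l (β x) + ⌈dist o (β x)⌉₊) = 0 by omega, hC.start,
        ← hγl _ _ hl, hγ0]
    · exact hγl _ _ (by omega)
  have hGstep : ∀ x n, dist (G x n) (G x (n + 1)) ≤ L := fun x n => by
    simp only [G]
    split_ifs with h1 h2 h2
    · rw [dist_comm, show N (β x) - n = N (β x) - (n + 1) + 1 by omega]
      exact hLstep _ _ _
    · rw [show N (β x) - n = 0 by omega, show n + 1 - N (β x) = 0 + 1 by omega, hC.start]
      nth_rewrite 1 [← hγ0 (β x)]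
      exact (hγs _ _).trans hL
    · omega
    · rw [show n + 1 - N (β x) = n - N (β x) + 1 by omega]
      exact (hγs _ _).trans hL
  have hGfar : ∀ R : ℝ, ∃ R' : ℝ, ∀ x ∈ A, R' ≤ dist o x → ∀ n, R ≤ dist o (G x n) := by
    intro R
    obtain ⟨R₁, hR₁⟩ := hβ.small
    obtain ⟨R₂, hR₂⟩ := hγ R
    obtain ⟨R₃, hR₃⟩ := hβ.exists_bound hM2 R₂
    refine ⟨max (max R₁ R₃) (2 * R), fun x hx hRx n => ?_⟩
    simp only [max_le_iff] at hRx
    simp only [G]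
    split_ifs with h
    -- The combing path stays within `(1 + L) * dist x (β x)` of `x`. By `M ≥ 2 * (1 + L)` this is
    -- at most half of `dist o x`.
    · have h1 := hR₁ x hx hRx.1.1
      have h2 := hLdist (β x) x (N (β x) - n)
      have h3 := mul_le_mul_of_nonneg_right hM (dist_nonneg (x := x) (y := β x))
      rw [dist_comm (β x) x] at h2
      linarith [dist_triangle_right o x (C (β x) x (N (β x) - n)),
        dist_triangle x (β x) (C (β x) x (N (β x) - n))]
    · exact (hR₂ _ (hR₃ x hx hRx.1.2)).2 _
  have hGdist : ∀ x (m n : ℕ), dist (G x m) (G x n) ≤ L * |(m : ℝ) - n| := fun x =>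
    dist_le_of_dist_succ_le (hGstep x)
  refine ⟨fun t => ρ ⌊t⌋₊, fun a => (T (β a) : ℝ≥0), hρ, hjc, _, hqc,
    fun z => G z.1.1 ⌊z.1.2⌋₊, ⟨fun r hr => ?_, ?_⟩, fun x => ?_, fun x => ?_⟩
  · obtain ⟨F, hF, hFβ⟩ := hβ.exists_finite hX r
    obtain ⟨m, hm⟩ := (hF.image fun x => q (β x)).bddAbove
    obtain ⟨s, hs, hCs⟩ := hC.controlled r hr
    have hL0 : 0 ≤ L := by linarith
    have hLm : 0 ≤ L * m := by positivity
    have hLr : 0 ≤ L * (r + 1) := by positivity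
    refine ⟨r + L * m + L * m + (L * (r + 1) + s), by linarith, fun z w hzw => ?_⟩
    obtain ⟨hd1, hd2⟩ : dist (z.1.1 : X) w.1.1 < r ∧ dist z.1.2 w.1.2 < r := max_lt_iff.mp hzw
    -- Within one piece the control comes from the bicombing. Nearby points of different pieces lie
    -- in the finite set `F`, over which the durations are at most `m`.
    rcases hFβ z.1.1 z.1.1.2 w.1.1 w.1.1.2 hd1 with h | ⟨h1, h2⟩
    · have hsame : dist (G z.1.1 ⌊w.1.2⌋₊) (G w.1.1 ⌊w.1.2⌋₊) < s := by
        simp only [G, h]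
        split_ifs
        · refine hCs (β w.1.1, (z.1.1 : X), _) (β w.1.1, (w.1.1 : X), _) ?_
          simp only [Prod.dist_eq, dist_self]
          exact max_lt hr (max_lt hd1 hr)
        · rwa [dist_self]
      have h3 := hGdist z.1.1 ⌊z.1.2⌋₊ ⌊w.1.2⌋₊
      have h4 : L * |((⌊z.1.2⌋₊ : ℝ) - ⌊w.1.2⌋₊)| ≤ L * (r + 1) :=
        mul_le_mul_of_nonneg_left (by linarith [(abs_floor_sub_floor z.1.2 w.1.2).1]) hL0
      linarith [dist_triangle (G z.1.1 ⌊z.1.2⌋₊) (G z.1.1 ⌊w.1.2⌋₊) (G w.1.1 ⌊w.1.2⌋₊)]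
    · have key : ∀ v : Cylinder fun a : A => (q (β a) : ℝ≥0), (v.1.1 : X) ∈ F →
          dist (v.1.1 : X) (G v.1.1 ⌊v.1.2⌋₊) ≤ L * m := by
        intro v hv
        have h3 := hGdist v.1.1 0 ⌊v.1.2⌋₊
        rw [hG0 _ v.1.1.2] at h3
        refine h3.trans (mul_le_mul_of_nonneg_left ?_ hL0)
        have h4 : ⌊v.1.2⌋₊ ≤ m :=
          (Nat.floor_le_of_le v.2).trans (hm (Set.mem_image_of_mem _ hv))
        rw [Nat.cast_zero, zero_sub, abs_neg, Nat.abs_cast]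
        exact_mod_cast h4
      have h3 := key z h1
      have h4 := key w h2
      rw [dist_comm] at h3
      linarith [dist_triangle4 (G z.1.1 ⌊z.1.2⌋₊) z.1.1 w.1.1 (G w.1.1 ⌊w.1.2⌋₊)]
  · refine isProperMap_of_bound (Cylinder.bot _ ⟨a₀, ha₀⟩) o fun c => ?_
    obtain ⟨R, hR⟩ := hGfar (c + 1)
    obtain ⟨m, hm⟩ := ((hX.finite_closedBall o R).image fun x => q (β x)).bddAbove
    refine ⟨max (dist a₀ o + R) m, fun z hz => ?_⟩
    have hzR : dist o (z.1.1 : X) < R := by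
      by_contra! hlt
      linarith [hR _ z.1.1.2 hlt ⌊z.1.2⌋₊]
    refine max_le_max ?_ ?_
    · have : dist a₀ (z.1.1 : X) ≤ dist a₀ o + dist o (z.1.1 : X) := dist_triangle _ _ _
      exact this.trans (by linarith)
    · have h1 : q (β z.1.1) ≤ m := hm (Set.mem_image_of_mem _ (by
        rw [Metric.mem_closedBall, dist_comm]; exact hzR.le))
      have h2 : z.1.2 ≤ (m : ℝ≥0) := z.2.trans (Nat.cast_le.mpr h1)
      change dist (0 : ℝ≥0) z.1.2 ≤ m
      rw [NNReal.dist_eq, NNReal.coe_zero, zero_sub, abs_neg, NNReal.abs_eq]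
      exact_mod_cast h2
  · simpa [Cylinder.bot] using hG0 x x.2
  · simpa [Cylinder.top] using hGtop x

end IsCollapse

/-- The bound on the coarse category of a discrete geodesic space. -/
theorem IsDiscreteGeodesic.ccatLE (hX : IsDiscreteGeodesic X) [Infinite X] (hb : IsBicombable X)
    (hconn : IsCoarselyPathConnected X) {n : ℕ} (h : AsdimLE X n) : CcatLE X n := by
  obtain ⟨C, hC⟩ := hb
  obtain ⟨L, hL, hLstep, hLdist⟩ := hX.exists_bicombing_bound hC
  obtain ⟨o⟩ : Nonempty X := inferInstance
  have hunb : ¬ Bornology.IsBounded (Set.univ : Set X) := fun hbd => by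
    obtain ⟨r, hr⟩ := (Metric.isBounded_iff_subset_closedBall o).mp hbd
    exact Set.infinite_univ ((hX.finite_closedBall o r).subset hr)
  obtain ⟨A, hA, hβ⟩ := h.exists_collapse_cover hunb o (M := 2 * (1 + L)) (by linarith)
  refine ⟨A, fun i => ?_, Set.eq_univ_of_forall fun x => Set.mem_iUnion.mpr (hA x)⟩
  obtain ⟨β, hβi⟩ := hβ i
  exact hβi.isCoarselyCategorical hX hC hL hLstep hLdist hconn le_rfl

end Categorical

/-! ### The word metric is discrete geodesic. -/

section WordMetric

variable {Γ : Type u} [Group Γ] {S : Set Γ}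

theorem dist_wordSpace (hS : Subgroup.closure S = ⊤) (g h : Γ) :
    @dist (WordSpace S hS) _ g h = wordLength S (g⁻¹ * h) := rfl

theorem exists_mul_of_wordLength_eq_succ (hS : Subgroup.closure S = ⊤) {g : Γ} {n : ℕ}
    (hg : wordLength S g = n + 1) :
    ∃ s h : Γ, (s ∈ S ∨ s⁻¹ ∈ S) ∧ s * h = g ∧ wordLength S h ≤ n := by
  obtain ⟨l, hl, hp, hn⟩ := isWordOfLength_wordLength hS g
  rw [hg] at hn
  obtain ⟨s, l, rfl⟩ := List.exists_cons_of_length_eq_add_one hn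
  exact ⟨s, l.prod, hl s (by simp), by simpa using hp,
    wordLength_le ⟨l, fun x hx => hl x (by simp [hx]), rfl, by simpa using hn⟩⟩

theorem wordLength_le_one {s : Γ} (hs : s ∈ S ∨ s⁻¹ ∈ S) : wordLength S s ≤ 1 :=
  wordLength_le ⟨[s], by simpa using hs, by simp, rfl⟩

theorem finite_wordLength_le (hfin : S.Finite) (hS : Subgroup.closure S = ⊤) (n : ℕ) :
    {g : Γ | wordLength S g ≤ n}.Finite := by
  induction n with
  | zero =>
    refine (Set.finite_singleton (1 : Γ)).subset fun g hg => ?_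
    exact eq_one_of_wordLength_eq_zero hS (Nat.le_zero.mp hg)
  | succ n ih =>
    refine (((hfin.union hfin.inv).mul ih).union ih).subset fun g hg => ?_
    rcases Nat.le_succ_iff_eq_or_le.mp hg with h | h
    · obtain ⟨s, h, hs, rfl, hn⟩ := exists_mul_of_wordLength_eq_succ hS h
      exact Or.inl (Set.mul_mem_mul hs hn)
    · exact Or.inr h

theorem isDiscreteGeodesic_wordSpace (hfin : S.Finite) (hS : Subgroup.closure S = ⊤) :
    IsDiscreteGeodesic (WordSpace S hS) where
  dist_nat g h := ⟨_, rfl⟩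
  step := by
    intro (g : Γ) (k : Γ) hgk
    have hne : wordLength S (g⁻¹ * k) ≠ 0 := fun h0 =>
      hgk ((inv_mul_eq_one (G := Γ)).mp (eq_one_of_wordLength_eq_zero hS h0))
    obtain ⟨n, hn⟩ := Nat.exists_eq_succ_of_ne_zero hne
    obtain ⟨s, h, hs, hsh, hle⟩ := exists_mul_of_wordLength_eq_succ hS hn
    have h1 : wordLength S (g⁻¹ * (g * s)) ≤ 1 := by simpa using wordLength_le_one hs
    have h2 : wordLength S ((g * s)⁻¹ * k) ≤ n := by
      rwa [show (g * s)⁻¹ * k = h by rw [mul_inv_rev, mul_assoc, ← hsh, inv_mul_cancel_left]]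
    have h3 : wordLength S (g⁻¹ * k) ≤
        wordLength S (g⁻¹ * (g * s)) + wordLength S ((g * s)⁻¹ * k) := by
      simpa [mul_assoc] using wordLength_mul_le hS (g⁻¹ * (g * s)) ((g * s)⁻¹ * k)
    suffices ∃ z : Γ, @dist (WordSpace S hS) _ g z = 1 ∧
        @dist (WordSpace S hS) _ g k = 1 + @dist (WordSpace S hS) _ z k from this
    refine ⟨g * s, ?_, ?_⟩
    · rw [dist_wordSpace hS, show wordLength S (g⁻¹ * (g * s)) = 1 by omega, Nat.cast_one]
    · rw [dist_wordSpace hS, dist_wordSpace hS,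
        show wordLength S (g⁻¹ * k) = 1 + wordLength S ((g * s)⁻¹ * k) by omega]
      push_cast
      ring
  finite_closedBall := by
    intro (g : Γ) r
    refine ((finite_wordLength_le hfin hS ⌈r⌉₊).image fun h => g * h).subset
      fun (h : Γ) hh => ⟨g⁻¹ * h, ?_, mul_inv_cancel_left g h⟩
    have hle : (wordLength S (g⁻¹ * h) : ℝ) ≤ r :=
      (dist_comm (α := WordSpace S hS) g h).trans_le hh
    exact_mod_cast hle.trans (Nat.le_ceil r)

end WordMetric

/-! ### Pulling back categorical sets along coarse maps. -/

section CoarseEquivalence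

variable {X : Type u} {Y : Type v} [MetricSpace X] [MetricSpace Y]

theorem IsCoarse.comp {X Y Z : Type*} [PseudoMetricSpace X] [PseudoMetricSpace Y]
    [PseudoMetricSpace Z] {g : Y → Z} {f : X → Y} (hg : IsCoarse g)
    (hf : IsCoarse f) : IsCoarse (g ∘ f) := by
  refine ⟨fun r hr => ?_, fun B hB => hf.2 _ (hg.2 B hB)⟩
  obtain ⟨s, hs, hfs⟩ := hf.1 r hr
  obtain ⟨t, ht, hgt⟩ := hg.1 s hs
  exact ⟨t, ht, fun x x' h => hgt _ _ (hfs _ _ h)⟩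

theorem IsCoarse.of_areClose {X Y : Type*} [PseudoMetricSpace X] [PseudoMetricSpace Y] {f g : X → Y}
    (hf : IsCoarse f) (hfg : AreClose f g) : IsCoarse g := by
  obtain ⟨M, hM⟩ := hfg
  refine ⟨fun r hr => ?_, fun B hB => ?_⟩
  · obtain ⟨s, hs, hfs⟩ := hf.1 r hr
    refine ⟨s + 2 * |M|, by positivity, fun x x' h => ?_⟩
    have h1 := (hM x).trans (le_abs_self M)
    have h2 := (hM x').trans (le_abs_self M)
    rw [dist_comm] at h1
    linarith [hfs x x' h, dist_triangle4 (g x) (f x) (f x') (g x')]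
  · refine (hf.2 _ (hB.cthickening (δ := M))).subset fun x hx => ?_
    exact Metric.mem_cthickening_of_dist_le _ _ _ _ hx (hM x)

theorem IsCoarse.restrict_preimage {φ : X → Y} (hφ : IsCoarse φ) (A : Set Y) :
    IsCoarse fun b : (φ ⁻¹' A : Set X) => (⟨φ b, b.2⟩ : A) := by
  refine ⟨fun r hr => ?_, fun B hB => ?_⟩
  · obtain ⟨s, hs, h⟩ := hφ.1 r hr
    exact ⟨s, hs, fun x x' hx => h _ _ hx⟩
  · obtain ⟨K, hK⟩ := Metric.isBounded_iff.mp (hφ.2 _ (Metric.isBounded_iff.mpr (by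
      obtain ⟨K, hK⟩ := Metric.isBounded_iff.mp hB
      exact ⟨K, fun _ ⟨a, ha, hax⟩ _ ⟨b, hb, hbx⟩ => by
        subst hax hbx
        exact hK ha hb⟩ : ∃ K : ℝ, ∀ ⦃x⦄, x ∈ (Subtype.val '' B : Set Y) → ∀ ⦃y⦄,
          y ∈ (Subtype.val '' B : Set Y) → dist x y ≤ K)))
    exact Metric.isBounded_iff.mpr ⟨K, fun x hx y hy => hK ⟨_, hx, rfl⟩ ⟨_, hy, rfl⟩⟩

/-- Preimages of coarsely categorical sets under coarse maps with a coarse left inverse. -/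
theorem IsCoarselyCategorical.preimage {φ : X → Y} {ψ : Y → X} (hφ : IsCoarse φ)
    (hψ : IsCoarse ψ) (hψφ : AreClose (ψ ∘ φ) id) {A : Set Y} (hA : IsCoarselyCategorical A) :
    IsCoarselyCategorical (φ ⁻¹' A) := by
  obtain ⟨α, j, hα, hj, p, hp, H, hH, hbot, htop⟩ := hA
  let φA : (φ ⁻¹' A : Set X) → A := fun b => ⟨φ b, b.2⟩
  have hφA : IsCoarse φA := hφ.restrict_preimage A
  -- The transported homotopy starts at `ψ ∘ φ` instead of the inclusion. An extra unit of time
  -- repairs this: `H'` rests at the given point while `t < 1` and then jumps a bounded distance, as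
  -- continuity is not required.
  let p' : (φ ⁻¹' A : Set X) → ℝ≥0 := fun b => p (φA b) + 1
  have hp' : IsCoarse p' := (hp.comp hφA).of_areClose ⟨1, fun x => by
    simp [p', NNReal.dist_eq]⟩
  let τ : Cylinder p' → Cylinder p := fun z =>
    ⟨(φA z.1.1, z.1.2 - 1), tsub_le_iff_right.mpr z.2⟩
  have hτd : ∀ s t : ℝ≥0, dist (s - 1) (t - 1) ≤ dist s t ∧ dist s t ≤ dist (s - 1) (t - 1) + 1 := by
    intro s t
    simp only [NNReal.dist_eq, NNReal.coe_sub_def, NNReal.coe_one]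
    have hs := s.2
    have ht := t.2
    simp only [NNReal.val_eq_coe] at hs ht
    constructor
    · rw [abs_le]
      rcases max_cases ((s : ℝ) - 1) 0 with h1 | h1 <;>
      rcases max_cases ((t : ℝ) - 1) 0 with h2 | h2 <;>
      rcases abs_cases ((s : ℝ) - t) with h3 | h3 <;> constructor <;> linarith
    · rcases max_cases ((s : ℝ) - 1) 0 with h1 | h1 <;>
      rcases max_cases ((t : ℝ) - 1) 0 with h2 | h2 <;>
      rcases abs_cases ((s : ℝ) - t) with h3 | h3 <;>
      rcases abs_cases (max ((s : ℝ) - 1) 0 - max ((t : ℝ) - 1) 0) with h4 | h4 <;> linarith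
  have hτ : IsCoarse τ := by
    refine ⟨fun r hr => ?_, fun B hB => ?_⟩
    · obtain ⟨s, hs, h⟩ := hφA.1 r hr
      refine ⟨max r s, lt_max_of_lt_left hr, fun z w hzw => ?_⟩
      obtain ⟨h1, h2⟩ : dist z.1.1 w.1.1 < r ∧ dist z.1.2 w.1.2 < r := max_lt_iff.mp hzw
      exact max_lt ((h _ _ h1).trans_le (le_max_right _ _))
        (((hτd _ _).1.trans_lt h2).trans_le (le_max_left _ _))
    · obtain ⟨K, hK⟩ := Metric.isBounded_iff.mp hB
      have hfst : Bornology.IsBounded ((fun z : Cylinder p => z.1.1) '' B) :=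
        Metric.isBounded_iff.mpr ⟨K, by
          rintro _ ⟨z, hz, rfl⟩ _ ⟨w, hw, rfl⟩
          exact (le_max_left _ _).trans (hK hz hw)⟩
      obtain ⟨K', hK'⟩ := Metric.isBounded_iff.mp (hφA.2 _ hfst)
      refine Metric.isBounded_iff.mpr ⟨max K' (K + 1), fun z hz w hw => max_le_max ?_ ?_⟩
      · have hmem : ∀ v ∈ τ ⁻¹' B, v.1.1 ∈ φA ⁻¹' ((fun z : Cylinder p => z.1.1) '' B) :=
          fun v hv => ⟨τ v, hv, rfl⟩
        exact hK' (hmem z hz) (hmem w hw)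
      · have : dist (z.1.2 - 1) (w.1.2 - 1) ≤ K := (le_max_right _ _).trans (hK hz hw)
        linarith [(hτd z.1.2 w.1.2).2]
  obtain ⟨M, hM⟩ := hψφ
  let H' : Cylinder p' → X := fun z => if z.1.2 < 1 then z.1.1 else ψ (H (τ z))
  have hH' : IsCoarse H' := (hψ.comp (hH.comp hτ)).of_areClose ⟨max M 0, fun z => by
    simp only [H', Function.comp]
    split_ifs with h
    · have : τ z = Cylinder.bot p (φA z.1.1) :=
        Subtype.ext (Prod.ext rfl (tsub_eq_zero_of_le h.le))
      rw [this, hbot]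
      exact (hM z.1.1).trans (le_max_left _ _)
    · rw [dist_self]
      exact le_max_right _ _⟩
  refine ⟨ψ ∘ α, j ∘ φA, hψ.comp hα, hj.comp hφA, p', hp', H', hH', fun x => ?_, fun x => ?_⟩
  · simp [H', Cylinder.bot]
  · have h1 : ¬ (Cylinder.top p' x).1.2 < 1 := by simp [Cylinder.top, p']
    have h2 : τ (Cylinder.top p' x) = Cylinder.top p (φA x) :=
      Subtype.ext (Prod.ext rfl (by simp [τ, Cylinder.top, p']))
    simp only [H', h1, if_false, h2, htop]
    rfl

theorem CcatLE.of_coarse {φ : X → Y} {ψ : Y → X} (hφ : IsCoarse φ) (hψ : IsCoarse ψ)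
    (hψφ : AreClose (ψ ∘ φ) id) {n : ℕ} (h : CcatLE Y n) : CcatLE X n := by
  obtain ⟨U, hU, hcov⟩ := h
  refine ⟨fun i => φ ⁻¹' U i, fun i => (hU i).preimage hφ hψ hψφ, ?_⟩
  rw [← Set.preimage_iUnion, hcov, Set.preimage_univ]

end CoarseEquivalence

/-! ### Orbit maps of geometric models. -/

section MilnorSchwarz

variable {Γ : Type u} [Group Γ] {S : Set Γ} {X : Type v} [MetricSpace X] [MulAction Γ X]

theorem IsGeometricModel.finite_setOf_dist_le (hX : IsGeometricModel Γ X) (x₀ : X) (r : ℝ) :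
    {g : Γ | dist x₀ (g • x₀) ≤ r}.Finite := by
  have := hX.proper
  have := hX.properAction
  refine (ProperlyDiscontinuousSMul.finite_disjoint_inter_image (Γ := Γ)
    (isCompact_singleton (x := x₀)) (isCompact_closedBall x₀ r)).subset fun g hg => ?_
  exact ⟨g • x₀, ⟨x₀, rfl, rfl⟩, by rwa [Metric.mem_closedBall, dist_comm]⟩

/-- The Milnor–Schwarz lemma: orbit maps have a coarse inverse. -/
theorem IsGeometricModel.exists_coarse_maps (hX : IsGeometricModel Γ X) (hfin : S.Finite)
    (hS : Subgroup.closure S = ⊤) :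
    ∃ (φ : X → WordSpace S hS) (ψ : WordSpace S hS → X), IsCoarse φ ∧ IsCoarse ψ ∧
      AreClose (ψ ∘ φ) id := by
  obtain ⟨x₀⟩ := hX.nonempty
  have hd : ∀ (g : Γ) (x y : X), dist (g • x) (g • y) = dist x y := fun g => (hX.isometric g).dist_eq
  have horb : ∀ g h : Γ, dist (g • x₀) (h • x₀) = dist x₀ ((g⁻¹ * h) • x₀) := fun g h => by
    rw [← hd g x₀, smul_smul, mul_inv_cancel_left]
  obtain ⟨K, hK, hcov⟩ := hX.cocompact
  obtain ⟨D, hD⟩ := (Metric.isBounded_iff_subset_closedBall x₀).mp hK.isBounded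
  have hφ : ∀ x : X, ∃ g : Γ, dist (g • x₀) x ≤ D := fun x => by
    obtain ⟨g, y, hy, rfl⟩ := Set.mem_iUnion.mp (hcov ▸ Set.mem_univ x)
    refine ⟨g, ?_⟩
    change dist (g • x₀) (g • y) ≤ D
    rw [hd, dist_comm]
    exact hD hy
  choose φ hφ using hφ
  let ψ : WordSpace S hS → X := fun g => (show Γ from g) • x₀
  have hlen : ∀ r : ℝ, ∃ m : ℕ, ∀ g : Γ, dist x₀ (g • x₀) ≤ r → wordLength S g ≤ m := fun r => by
    obtain ⟨m, hm⟩ := ((hX.finite_setOf_dist_le x₀ r).image (wordLength S)).bddAbove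
    exact ⟨m, fun g hg => hm ⟨g, hg, rfl⟩⟩
  have hψc : IsCoarse ψ := by
    refine ⟨fun r hr => ?_, isProperMap_of_bound (show WordSpace S hS from (1 : Γ)) x₀ fun c => ?_⟩
    · obtain ⟨m, hm⟩ := ((finite_wordLength_le hfin hS ⌈r⌉₊).image
        fun g => dist x₀ (g • x₀)).bddAbove
      refine ⟨max m 0 + 1, by positivity, fun (g : Γ) (h : Γ) hgh => ?_⟩
      rw [dist_wordSpace hS] at hgh
      have : dist (g • x₀) (h • x₀) ≤ m := by
        rw [horb]
        exact hm ⟨_, by exact_mod_cast hgh.le.trans (Nat.le_ceil r), rfl⟩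
      exact this.trans_lt ((le_max_left m 0).trans_lt (lt_add_one _))
    · obtain ⟨m, hm⟩ := hlen c
      refine ⟨m, fun (g : Γ) hg => ?_⟩
      rw [dist_wordSpace hS, inv_one, one_mul]
      exact_mod_cast hm g hg
  refine ⟨φ, ψ, ⟨fun r hr => ?_, fun B hB => ?_⟩, hψc, D, hφ⟩
  -- Passing from `x` and `y` to the chosen orbit points costs `D` at each end; proper discontinuity
  -- leaves finitely many group elements with displacement at most `r + 2 * D`.
  · obtain ⟨m, hm⟩ := hlen (r + 2 * D)
    refine ⟨m + 1, by positivity, fun x y hxy => ?_⟩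
    rw [dist_wordSpace hS]
    have := hm ((φ x)⁻¹ * φ y) (by
      rw [← horb]
      have h1 := hφ y
      rw [dist_comm] at h1
      linarith [dist_triangle4 (φ x • x₀) x y (φ y • x₀), hφ x])
    exact_mod_cast Nat.lt_succ_of_le this
  · have hBfin : B.Finite := by
      obtain ⟨r, hr⟩ := (Metric.isBounded_iff_subset_closedBall
        (show WordSpace S hS from (1 : Γ))).mp hB
      exact ((isDiscreteGeodesic_wordSpace hfin hS).finite_closedBall _ r).subset hr
    refine ((hBfin.image ψ).isBounded.cthickening (δ := D)).subset fun x hx => ?_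
    exact Metric.mem_cthickening_of_dist_le x _ _ _ ⟨φ x, hx, rfl⟩ (by
      rw [dist_comm]
      exact hφ x)

end MilnorSchwarz

end CoarseLS

open CoarseLS in
theorem theorem5p3 {Γ : Type*} [Group Γ] [Infinite Γ]
    (S : Set Γ) (hfin : S.Finite) (hS : Subgroup.closure S = ⊤)
    (hbicomb : IsBicombable (WordSpace S hS))
    (hconn : IsCoarselyPathConnected (WordSpace S hS)) :
    ccat (WordSpace S hS) ≤ asdim (WordSpace S hS) ∧
      ∀ (X : Type*) [MetricSpace X] [MulAction Γ X],
        IsGeometricModel Γ X → ccat X ≤ asdim (WordSpace S hS) := by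
  have : Infinite (WordSpace S hS) := ‹Infinite Γ›
  have key : ∀ n, AsdimLE (WordSpace S hS) n → CcatLE (WordSpace S hS) n := fun n h =>
    (isDiscreteGeodesic_wordSpace hfin hS).ccatLE hbicomb hconn h
  refine ⟨le_iInf₂ fun n h => iInf₂_le n (key n h), fun X _ _ hX => ?_⟩
  obtain ⟨φ, ψ, hφ, hψ, hψφ⟩ := hX.exists_coarse_maps hfin hS
  exact le_iInf₂ fun n h => iInf₂_le n ((key n h).of_coarse hφ hψ hψφ)
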